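/- **Setting.** Fix constants $D,G,H,a,\delta>0$. Let $T\ge 1$, let $\mathcal X\subseteq\mathbb R^d$ be closed and convex with $\mathbf 0\in\mathcal X$ and $\|\mathbf x-\mathbf y\|\le D$ for all $\mathbf x,\mathbf y\in\mathcal X$, let $\Pi_{\mathcal X}$ be the Euclidean projection onto $\mathcal X$, and put $\mathcal Y=\{\mathbf y:\|\mathbf y\|\le D\}$. For $t=1,\dots,T$ the loss $f_t$ is differentiable, $\|\nabla f_t\|\le G$ on $\mathcal X$, and $f_t$ is non-negative and $H$-smooth (its gradient is $H$-Lipschitz) on the set $\{\mathbf z:\mathrm{dist}(\mathbf z,\mathcal X)\le G/H\}$; for instance, it suffices that $f_t$ is non-negative and $H$-smooth on $\mathbb R^d$. **Algorithm.** Let $N=\lceil\log_2T\rceil$ and $\mathcal P=\{2^k/T:0\le k\le N\}$. The experts are: one for convex losses, one for each $\hat\alpha\in\mathcal P$, and one for each $\hat\lambda\in\mathcal P$, so there are $K=2N+3$ of them. Their first points $\mathbf y_1^i\in\mathcal Y$ are arbitrary. In round $t$ the algorithm forms $\mathbf y_t=\sum_ip_t^i\mathbf y_t^i$, submits $\mathbf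 x_t=\Pi_{\mathcal X}[\mathbf y_t]$, observes $\nabla f_t(\mathbf x_t)$, and puts $$\mathbf g_t=\nabla f_t(\mathbf x_t)-\mathbb 1_{\{\langle\nabla f_t(\mathbf x_t),\mathbf v_t\rangle<0\}}\langle\nabla f_t(\mathbf x_t),\mathbf v_t\rangle\mathbf v_t,\qquad \mathbf v_t=\frac{\mathbf y_t-\mathbf x_t}{\|\mathbf y_t-\mathbf x_t\|}$$ ($\mathbf v_t=\mathbf 0$ if $\mathbf y_t=\mathbf x_t$). The experts are updated as follows. * *Convex expert (SOGD)*, with loss $\langle\mathbf g_t,\mathbf y-\mathbf y_t\rangle$: $\mathbf y^i_{t+1}$ is the Euclidean projection onto $\mathcal Y$ of $\mathbf y^i_t-a\,\mathbf g_t\big/\sqrt{\delta+\sum_{s\le t}\|\mathbf g_s\|^2}$. * *Exp-concave expert $\hat\alpha$ (ONS)*, with $\hat\beta=\frac12\min\{\frac1{4GD},\hat\alpha\}$ and loss $\ell_t(\mathbf y)=\langle\mathbf g_t,\mathbf y-\mathbf y_t\rangle+\frac{\hat\beta}2\langle\mathbf g_t,\mathbf y-\mathbf y_t\rangle^2$: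 with $\Sigma_1=\frac1{\hat\beta^2D^2}\mathbf I_d$ and $\Sigma_{t+1}=\Sigma_t+\nabla\ell_t(\mathbf y_t^i)\nabla\ell_t(\mathbf y_t^i)^\top$, $\mathbf y^i_{t+1}$ is the projection onto $\mathcal Y$, in the norm $\mathbf v\mapsto\sqrt{\mathbf v^\top\Sigma_{t+1}\mathbf v}$, of $\mathbf y_t^i-\frac1{\hat\beta}\Sigma_{t+1}^{-1}\nabla\ell_t(\mathbf y_t^i)$. * *Strongly convex expert $\hat\lambda$ (S$^2$OGD)*, with loss $\hat\ell_t(\mathbf y)=\langle\mathbf g_t,\mathbf y-\mathbf y_t\rangle+\frac{\hat\lambda}{2G^2}\|\mathbf g_t\|^2\|\mathbf y-\mathbf x_t\|^2$: $\mathbf y^i_{t+1}$ is the Euclidean projection onto $\mathcal Y$ of $\mathbf y_t^i-\eta_t\nabla\hat\ell_t(\mathbf y_t^i)$, where $\eta_t=A\big/\big((1+\frac{2D}G)^2A+\sum_{s\le t}\|\nabla\hat\ell_s(\mathbf y_s^i)\|^2\big)$ and $A=(G+2D)^2/\hat\lambda$. The weights come from Adapt-ML-Prod. With meta-losses $\ell_t^i=\frac{\langle\mathbf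 g_t,\mathbf y_t^i-\mathbf y_t\rangle}{4GD}+\frac12$, $\ell_t=\sum_ip_t^i\ell_t^i$ and $\eta_t^i=\min\big\{\frac12,\sqrt{\ln K/(1+\sum_{s\le t}(\ell_s-\ell_s^i)^2)}\big\}$, $$w_0^i=\tfrac1K,\qquad w_t^i=\big(w_{t-1}^i(1+\eta_{t-1}^i(\ell_t-\ell_t^i))\big)^{\eta_t^i/\eta_{t-1}^i},\qquad p_t^i=\frac{\eta_{t-1}^iw_{t-1}^i}{\sum_j\eta_{t-1}^jw_{t-1}^j}.$$ **Theorem.** The algorithm performs exactly one projection onto $\mathcal X$ in every round. Moreover, there is a constant $C>0$ depending only on $D,G,H,a,\delta$ such that, for all $d$, $T$, first points, $\mathcal X$ and $f_1,\dots,f_T$ as above, the minimum $L_T=\min_{\mathbf x\in\mathcal X}\sum_{t=1}^Tf_t(\mathbf x)$ exists and, with $\mathrm{Reg}_T=\sum_{t=1}^Tf_t(\mathbf x_t)-L_T$ and $\kappa_T=1+\ln(1+\ln T)$: 1. if all $f_t$ are convex on $\mathcal X$, then $\mathrm{Reg}_T\le C\big(\sqrt{\kappa_TL_T}+\kappa_T\big)$;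 2. if $\alpha\in[1/T,1]$ and all $f_t$ are $\alpha$-exp-concave on $\mathcal X$ (that is, $e^{-\alpha f_t}$ is concave on $\mathcal X$), then $\mathrm{Reg}_T\le\frac C\alpha\big(d\,(1+\ln(1+L_T))+\kappa_T\big)$; 3. if $\lambda\in[1/T,1]$ and all $f_t$ are $\lambda$-strongly convex on $\mathcal X$ (that is, $f_t(\mathbf y)\ge f_t(\mathbf x)+\langle\nabla f_t(\mathbf x),\mathbf y-\mathbf x\rangle+\frac\lambda2\|\mathbf y-\mathbf x\|^2$ for $\mathbf x,\mathbf y\in\mathcal X$), then $\mathrm{Reg}_T\le\frac C\lambda\big(\ln(1+L_T)+\kappa_T\big)$. If the $O(\log\log T)$ factor $\kappa_T$ is treated as a constant, as is customary, these are the rates $O(\sqrt{L_T})$, $O(\frac d\alpha\log L_T)$ and $O(\frac1\lambda\log L_T)$. -/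

import Mathlib

open scoped Matrix

noncomputable section

/-! ### Programs that may query a projection oracle, and online learners -/

/-- A program over `E` with result in `α` which may query an oracle for the projection onto the
feasible domain: either it returns, or it submits a point to the oracle and goes on with the
answer.  This is the only access a program has to the feasible domain. -/
inductive ProjProg (E α : Type) : Type
  | ret (a : α) : ProjProg E α
  | project (y : E) (k : E → ProjProg E α) : ProjProg E α

namespace ProjProg

/-- The result of a program when the oracle answers by `P`. -/
def eval {E α : Type} (P : E → E) : ProjProg E α → α
  | ret a => a
  | project y k => (k (P y)).eval P

/-- The number of projections that a program performs when the oracle answers by `P`. -/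
def calls {E α : Type} (P : E → E) : ProjProg E α → ℕ
  | ret _ => 0
  | project y k => (k (P y)).calls P + 1

end ProjProg

/-- A deterministic online learner with gradient feedback.  In each round it produces a decision
(`act`), is told the gradient of the current loss at this decision, and updates its state. Both
parts of a round may use the projection oracle. -/
structure OnlineLearner (E : Type) where
  State : Type
  Memory : Type
  start : State
  act : State → ProjProg E (E × Memory)
  update : Memory → E → ProjProg E State

namespace OnlineLearner

variable {E : Type}

/-- State at the beginning of round `t` (rounds are numbered `0, 1, 2, …`), where `P` answers the
projection queries and `grad t x` is the gradient of the loss of round `t` at `x`. -/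
def stateAt (A : OnlineLearner E) (P : E → E) (grad : ℕ → E → E) : ℕ → A.State
  | 0 => A.start
  | t + 1 =>
    let r := (A.act (A.stateAt P grad t)).eval P
    (A.update r.2 (grad t r.1)).eval P

/-- The decision submitted in round `t`. -/
def decision (A : OnlineLearner E) (P : E → E) (grad : ℕ → E → E) (t : ℕ) : E :=
  ((A.act (A.stateAt P grad t)).eval P).1

/-- The number of projections performed in the whole of round `t`. -/
def projCount (A : OnlineLearner E) (P : E → E) (grad : ℕ → E → E) (t : ℕ) : ℕ :=
  let r := (A.act (A.stateAt P grad t)).eval P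
  (A.act (A.stateAt P grad t)).calls P + (A.update r.2 (grad t r.1)).calls P

end OnlineLearner

/-! ### Surrogate gradient and expert-losses -/

/-- `ℝ^d` with the Euclidean norm. -/
abbrev Vec (d : ℕ) : Type := EuclideanSpace ℝ (Fin d)

/-- Gradient at `y` of the domain-converting surrogate loss, where `x` is the projection of `y` and
`grad` is the gradient of the original loss at `x`.  The unit vector `v` is `0` if `y = x`, and then
the surrogate gradient is `grad`. -/
def surrGrad {d : ℕ} (y x grad : Vec d) : Vec d :=
  let v : Vec d := ‖y - x‖⁻¹ • (y - x)
  if inner ℝ grad v < 0 then grad - (inner ℝ grad v : ℝ) • v else grad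

/-- Expert-loss for convex functions; `g` is the surrogate gradient at the aggregated point `yt`. -/
def cvxLoss {d : ℕ} (g yt y : Vec d) : ℝ := inner ℝ g (y - yt)

/-- Expert-loss for exp-concave functions. -/
def expLoss {d : ℕ} (β : ℝ) (g yt y : Vec d) : ℝ :=
  inner ℝ g (y - yt) + β / 2 * (inner ℝ g (y - yt)) ^ 2

/-- Expert-loss for strongly convex and smooth functions; `xt` is the submitted decision. -/
def scLoss {d : ℕ} (mu G : ℝ) (g yt xt y : Vec d) : ℝ :=
  inner ℝ g (y - yt) + mu / (2 * G ^ 2) * ‖g‖ ^ 2 * ‖y - xt‖ ^ 2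

/-- Gradient of `expLoss` in `y`. -/
def expGrad {d : ℕ} (β : ℝ) (g yt y : Vec d) : Vec d :=
  g + (β * inner ℝ g (y - yt)) • g

/-- Gradient of `scLoss` in `y`. -/
def scGrad {d : ℕ} (mu G : ℝ) (g xt y : Vec d) : Vec d :=
  g + (mu / G ^ 2 * ‖g‖ ^ 2) • (y - xt)

theorem cvxLoss_hasGradientAt {d : ℕ} (g yt y : Vec d) :
    HasGradientAt (cvxLoss g yt) g y := by
  rw [hasGradientAt_iff_hasFDerivAt]
  have h : HasFDerivAt (fun z : Vec d => z - yt) (ContinuousLinearMap.id ℝ (Vec d)) y :=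
    (hasFDerivAt_id y).sub_const yt
  exact ((innerSL ℝ g).hasFDerivAt.comp y h).congr_fderiv (by ext z; simp)

theorem expLoss_hasGradientAt {d : ℕ} (β : ℝ) (g yt y : Vec d) :
    HasGradientAt (expLoss β g yt) (expGrad β g yt y) y := by
  have h := (hasGradientAt_iff_hasFDerivAt.1 (cvxLoss_hasGradientAt g yt y))
  rw [hasGradientAt_iff_hasFDerivAt]
  refine (h.add ((h.pow 2).const_mul (β / 2))).congr_fderiv ?_
  ext z
  simp [expGrad, cvxLoss]
  ring

theorem scLoss_hasGradientAt {d : ℕ} (mu G : ℝ) (g yt xt y : Vec d) :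
    HasGradientAt (scLoss mu G g yt xt) (scGrad mu G g xt y) y := by
  have h := (hasGradientAt_iff_hasFDerivAt.1 (cvxLoss_hasGradientAt g yt y))
  have h2 : HasFDerivAt (fun z : Vec d => z - xt) (ContinuousLinearMap.id ℝ (Vec d)) y :=
    (hasFDerivAt_id y).sub_const xt
  rw [hasGradientAt_iff_hasFDerivAt]
  refine (h.add (h2.norm_sq.const_mul (mu / (2 * G ^ 2) * ‖g‖ ^ 2))).congr_fderiv ?_
  ext z
  simp [scGrad]
  ring

/-! ### Expert-algorithms over the ball of radius `D` about the origin -/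

/-- Euclidean projection onto the ball, by rescaling. -/
def ballClip {d : ℕ} (D : ℝ) (z : Vec d) : Vec d :=
  if ‖z‖ ≤ D then z else (D / ‖z‖) • z

/-- `y` is a point of the ball that is nearest to `z` in the norm `v ↦ √(vᵀ M v)`. -/
def IsBallNearest {d : ℕ} (D : ℝ) (M : Matrix (Fin d) (Fin d) ℝ) (z y : Vec d) : Prop :=
  ‖y‖ ≤ D ∧ ∀ w : Vec d, ‖w‖ ≤ D →
    (y - z).ofLp ⬝ᵥ (M *ᵥ (y - z).ofLp) ≤ (w - z).ofLp ⬝ᵥ (M *ᵥ (w - z).ofLp)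

/-- Projection onto the ball in the norm given by the positive definite matrix `M`. -/
def ballProj {d : ℕ} (D : ℝ) (M : Matrix (Fin d) (Fin d) ℝ) (z : Vec d) : Vec d :=
  open Classical in if ‖z‖ ≤ D then z else Classical.epsilon (IsBallNearest D M z)

/-- One step of scale-free online gradient descent.  The state is the current point together with
the sum of the squared norms of the earlier gradients. -/
def sogdStep {d : ℕ} (D a δ : ℝ) (g : Vec d) (s : Vec d × ℝ) : Vec d × ℝ :=
  let S := s.2 + ‖g‖ ^ 2
  (ballClip D (s.1 - (a / √(δ + S)) • g), S)

/-- One step of the online Newton step on `expLoss β g yt`.  The state is the current point together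
with the current matrix. -/
def onsStep {d : ℕ} (D β : ℝ) (g yt : Vec d) (s : Vec d × Matrix (Fin d) (Fin d) ℝ) :
    Vec d × Matrix (Fin d) (Fin d) ℝ :=
  let h := expGrad β g yt s.1
  let M := s.2 + Matrix.vecMulVec h.ofLp h.ofLp
  (ballProj D M (s.1 - (1 / β) • WithLp.toLp 2 (M⁻¹ *ᵥ h.ofLp)), M)

/-- One step of smooth and strongly convex online gradient descent on `scLoss mu G g yt xt`.  The
state is the current point together with the sum of the squared norms of the gradients of the
earlier expert-losses.  The step size is `a / (δ + sum)`, with `a = (G + 2D)² / mu` and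
`δ = (1 + 2D/G)² a`. -/
def s2ogdStep {d : ℕ} (D G mu : ℝ) (g xt : Vec d) (s : Vec d × ℝ) : Vec d × ℝ :=
  let h := scGrad mu G g xt s.1
  let S := s.2 + ‖h‖ ^ 2
  let a := (G + 2 * D) ^ 2 / mu
  (ballClip D (s.1 - (a / ((1 + 2 * D / G) ^ 2 * a + S)) • h), S)

/-! ### The universal algorithm -/

/-- Indices of the moduli `2^k / T`, `k = 0, …, ⌈log₂ T⌉`. -/
abbrev ModIdx (T : ℕ) : Type := Fin (Nat.clog 2 T + 1)

/-- The experts: one for convex losses, one for every modulus of exp-concavity, and one for every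
modulus of strong convexity. -/
abbrev Expert (T : ℕ) : Type := Unit ⊕ (ModIdx T ⊕ ModIdx T)

/-- The modulus `2^k / T`. -/
def modulus (T : ℕ) (k : ModIdx T) : ℝ := 2 ^ (k : ℕ) / T

/-- The parameter `β = ½ min {1 / (4GD), α}` of an exp-concave expert. -/
def expParam (D G α : ℝ) : ℝ := 1 / 2 * min (1 / (4 * G * D)) α

/-- The input of the universal algorithm: the horizon `T`, the radius `D`, the bound `G` on the
gradients, the parameters `a`, `δ` of scale-free gradient descent, and the first point of every
expert. -/
structure UniversalInput (d : ℕ) where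
  T : ℕ
  D : ℝ
  G : ℝ
  a : ℝ
  δ : ℝ
  first : Expert T → Vec d

/-- State of the universal algorithm: the states of the experts and, for every expert, its weight in
the meta-algorithm and the sum `∑ (ℓ_s - ℓ_s^i)²` over the past rounds. -/
structure UniversalState (d T : ℕ) where
  cvx : Vec d × ℝ
  exp : ModIdx T → Vec d × Matrix (Fin d) (Fin d) ℝ
  sc : ModIdx T → Vec d × ℝ
  weight : Expert T → ℝ
  dev : Expert T → ℝ

namespace UniversalState

variable {d T : ℕ}

/-- The current point of an expert. -/
def point (s : UniversalState d T) : Expert T → Vec d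
  | Sum.inl _ => s.cvx.1
  | Sum.inr (Sum.inl k) => (s.exp k).1
  | Sum.inr (Sum.inr k) => (s.sc k).1

/-- Learning rate of the meta-algorithm for an expert whose sum of squares is `S`. -/
def rate (T : ℕ) (S : ℝ) : ℝ :=
  min (1 / 2) √(Real.log (Fintype.card (Expert T)) / (1 + S))

/-- The probability that the meta-algorithm gives to an expert. -/
def prob (s : UniversalState d T) (i : Expert T) : ℝ :=
  rate T (s.dev i) * s.weight i / ∑ j, rate T (s.dev j) * s.weight j

/-- The aggregated point. -/
def aggregate (s : UniversalState d T) : Vec d := ∑ i, s.prob i • s.point i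

/-- Meta-loss of an expert, where `g` is the surrogate gradient at the aggregated point. -/
def metaLoss (s : UniversalState d T) (D G : ℝ) (g : Vec d) (i : Expert T) : ℝ :=
  inner ℝ g (s.point i - s.aggregate) / (4 * G * D) + 1 / 2

/-- Loss of the meta-algorithm minus the meta-loss of an expert. -/
def metaGap (s : UniversalState d T) (D G : ℝ) (g : Vec d) (i : Expert T) : ℝ :=
  ∑ j, s.prob j * s.metaLoss D G g j - s.metaLoss D G g i

/-- The state in the first round. -/
def initial (I : UniversalInput d) : UniversalState d I.T where
  cvx := (I.first (Sum.inl ()), 0)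
  exp k := (I.first (Sum.inr (Sum.inl k)),
    (1 / ((expParam I.D I.G (modulus I.T k)) ^ 2 * I.D ^ 2)) • (1 : Matrix (Fin d) (Fin d) ℝ))
  sc k := (I.first (Sum.inr (Sum.inr k)), 0)
  weight _ := 1 / Fintype.card (Expert I.T)
  dev _ := 0

/-- The state in the next round, where `x` is the submitted decision and `grad` is the gradient of
the loss at `x`. -/
def next (I : UniversalInput d) (s : UniversalState d I.T) (x grad : Vec d) :
    UniversalState d I.T :=
  let y := s.aggregate
  let g := surrGrad y x grad
  let gap := s.metaGap I.D I.G g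
  { cvx := sogdStep I.D I.a I.δ g s.cvx
    exp := fun k => onsStep I.D (expParam I.D I.G (modulus I.T k)) g y (s.exp k)
    sc := fun k => s2ogdStep I.D I.G (modulus I.T k) g x (s.sc k)
    weight := fun i =>
      (s.weight i * (1 + rate I.T (s.dev i) * gap i)) ^
        (rate I.T (s.dev i + gap i ^ 2) / rate I.T (s.dev i))
    dev := fun i => s.dev i + gap i ^ 2 }

end UniversalState

/-- The universal algorithm for smooth losses.  It projects the aggregated point onto the feasible
domain, submits the result, and updates the experts and the meta-algorithm with the gradient. -/
def universalLearner {d : ℕ} (I : UniversalInput d) : OnlineLearner (Vec d) where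
  State := UniversalState d I.T
  Memory := UniversalState d I.T × Vec d
  start := UniversalState.initial I
  act s := .project s.aggregate fun x => .ret (x, (s, x))
  update m grad := .ret (UniversalState.next I m.1 m.2 grad)

/-! ### Assumptions on the domain and on the losses -/

/-- A closed convex set that contains the origin and has diameter at most `D`. -/
structure IsFeasibleDomain {d : ℕ} (X : Set (Vec d)) (D : ℝ) : Prop where
  closed : IsClosed X
  convex : Convex ℝ X
  zero_mem : 0 ∈ X
  dist_le : ∀ x ∈ X, ∀ y ∈ X, ‖x - y‖ ≤ D

/-- `P` is the Euclidean projection onto `X`. -/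
def IsProjectionOnto {d : ℕ} (P : Vec d → Vec d) (X : Set (Vec d)) : Prop :=
  ∀ y, P y ∈ X ∧ ∀ x ∈ X, ‖y - P y‖ ≤ ‖y - x‖

/-- `f` is `H`-smooth on `S`: it is differentiable and its gradient is `H`-Lipschitz there. -/
def IsSmoothOn {d : ℕ} (f : Vec d → ℝ) (H : ℝ) (S : Set (Vec d)) : Prop :=
  (∀ x ∈ S, DifferentiableAt ℝ f x) ∧
    ∀ x ∈ S, ∀ y ∈ S, ‖gradient f x - gradient f y‖ ≤ H * ‖x - y‖

/-- `f` has gradients of norm at most `G` on `X`, and is nonnegative and `H`-smooth on the set of all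
points at distance at most `G / H` from `X` (a gradient step of size `1 / H` from a point of `X` does
not leave this set). -/
structure IsAdmissibleLoss {d : ℕ} (f : Vec d → ℝ) (X : Set (Vec d)) (G H : ℝ) : Prop where
  grad_le : ∀ x ∈ X, ‖gradient f x‖ ≤ G
  nonneg : ∀ x ∈ Metric.cthickening (G / H) X, 0 ≤ f x
  smooth : IsSmoothOn f H (Metric.cthickening (G / H) X)

/-- `f` is `α`-exp-concave on `X`. -/
def IsExpConcaveOn {d : ℕ} (f : Vec d → ℝ) (α : ℝ) (X : Set (Vec d)) : Prop :=
  ConcaveOn ℝ X fun x => Real.exp (-α * f x)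

/-- `f` is `mu`-strongly convex on `X`, for differentiable `f`. -/
def IsStronglyConvexOn {d : ℕ} (f : Vec d → ℝ) (mu : ℝ) (X : Set (Vec d)) : Prop :=
  ∀ x ∈ X, ∀ y ∈ X, f x + inner ℝ (gradient f x) (y - x) + mu / 2 * ‖y - x‖ ^ 2 ≤ f y

/-- The factor `1 + log (1 + log T)`. -/
def logLog (T : ℕ) : ℝ := 1 + Real.log (1 + Real.log T)

end

/-!
The regret is linearized with the surrogate gradient `g` at the aggregated point `y`, whose
projection is the decision `x`.  For every comparator `z` of the domain
`⟪∇f x, x - z⟫ ≤ ⟪g, x - z⟫ ≤ ⟪g, y - z⟫` (`inner_le_inner_surrGrad`, `inner_surrGrad_nonneg`), and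
`‖g‖ ≤ ‖∇f x‖` (`norm_surrGrad_le`).  For an expert with points `yᵢ` this splits into the gap
`⟪g, y - yᵢ⟫`, which the meta-algorithm controls, and `⟪g, yᵢ - z⟫`, which the expert controls.

*Meta-algorithm.*  The total weight stays polynomial in the number `K` of experts, since it changes
only through the learning rates, whose relative changes telescope to a logarithm
(`meta_sum_weight_le`).  Comparing it with the weight of one expert bounds the sum of the gaps by
`O(log K + √(log K * (1 + ∑ gap²)))` (`meta_regret_le`), and `log K` is at most `3 * logLog T`
(`logCard_le`).  Hence the sum of the gaps minus `ρ` times the sum of their squares is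
`O(log K / ρ)` for bounded `ρ` (`IsRun.meta_sub_sq_le`).

*Experts.*  Scale-free gradient descent has regret `O(√(δ + ∑ ‖g‖²))` (`sogd_regret_le`); the other
two have logarithmic regret against quadratic models of their losses (`ons_regret_le` by the
log-determinant potential, `s2ogd_regret_le` by the growth of the inverse step size).  What remains
is to pay for the squares of the gaps.  For exp-concave losses the expert is taken with a modulus
that is smaller by a constant factor than the modulus of the losses; the surplus of the quadratic
model then pays both for the squared gaps and for the difference between the gradient of the
expert-loss and `g` (`IsRun.exp_tradeoff`).  If there is no such expert then `T` is `O(1 / α)` and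
there is nothing to prove.  For strongly convex losses the squared gap is paid by the quadratic term
of the expert-loss, centred at `x`, together with the slack `⟪g, y - x⟫` in the linearization
(`IsRun.sc_le`).

*Smoothness.*  A nonnegative smooth loss satisfies `‖∇f x‖² ≤ 4 H f x`
(`IsAdmissibleLoss.norm_gradient_sq_le`), so `∑ ‖g‖²` is bounded by the loss of the learner, which is
the regret plus the loss of `z`.  The resulting self-bounding inequalities are solved by
`le_of_le_mul_sqrt` and `le_of_le_log`.  In the logarithmic cases the unknown is the regret
multiplied by the modulus: the potentials carry the modulus inside the logarithm, so no
`log (1 / α)` appears.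
-/

/-! ### Scalar inequalities -/

theorem nonneg_of_forall_quadratic {b c : ℝ}
    (h : ∀ s : ℝ, 0 < s → s ≤ 1 → 0 ≤ 2 * s * b + s ^ 2 * c) : 0 ≤ b := by
  by_contra! hb
  have hc : 0 < |c| + 1 := by positivity
  have hc' := le_abs_self c
  set s := min 1 (-b / (|c| + 1)) with hs
  have hpos : 0 < s := lt_min one_pos (div_pos (by linarith) hc)
  have h1 := h s hpos (min_le_left _ _)
  have h2 : s * (|c| + 1) ≤ -b := by
    rw [← le_div_iff₀ hc]; exact min_le_right _ _
  have h3 : 0 ≤ 2 * b + s * c := by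
    by_contra! h4
    nlinarith
  nlinarith

theorem sub_sq_le_log_one_add {x : ℝ} (hx : -(1 / 4) ≤ x) : x - x ^ 2 ≤ Real.log (1 + x) := by
  have h1 : 0 < 1 + x := by linarith
  have h := Real.one_sub_inv_le_log_of_pos h1
  rcases le_or_gt 0 x with h0 | h0
  · have h2 : 1 - (1 + x)⁻¹ = x / (1 + x) := by field_simp; ring
    have h3 : x - x ^ 2 ≤ x / (1 + x) := by
      rw [le_div_iff₀ h1]; nlinarith [pow_nonneg h0 3]
    linarith
  · have h2 : Real.exp (x - x ^ 2) ≤ 1 + x := by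
      have h3 := Real.exp_bound (x := x - x ^ 2) (by rw [abs_le]; constructor <;> nlinarith)
        (n := 3) (by norm_num)
      norm_num [Finset.sum_range_succ, Nat.factorial] at h3
      have h4 := (abs_le.1 h3).2
      have h5 : |x - x ^ 2| = -(x - x ^ 2) := abs_of_nonpos (by nlinarith)
      rw [h5] at h4
      have h6 : (-(x - x ^ 2)) ^ 3 ≤ 5 / 16 * (x - x ^ 2) ^ 2 := by
        have : -(x - x ^ 2) ≤ 5 / 16 := by nlinarith
        nlinarith [sq_nonneg (x - x ^ 2)]
      have h7 : (x - x ^ 2) ^ 2 ≤ 25 / 16 * x ^ 2 := by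
        have : (x - x ^ 2) ^ 2 = x ^ 2 * (1 - x) ^ 2 := by ring
        rw [this, mul_comm]
        apply mul_le_mul_of_nonneg_right _ (sq_nonneg x)
        nlinarith
      nlinarith
    rwa [Real.le_log_iff_exp_le h1]

theorem log_one_add_le_sub_sq {z : ℝ} (hz : |z| ≤ 1 / 4) : Real.log (1 + z) ≤ z - z ^ 2 / 4 := by
  obtain ⟨hl, hu⟩ := abs_le.1 hz
  have h1 : 0 < 1 + z := by linarith
  rw [Real.log_le_iff_le_exp h1]
  set x := z - z ^ 2 / 4 with hx
  have h3 := Real.exp_bound (x := x) (by rw [abs_le]; constructor <;> nlinarith)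
    (n := 3) (by norm_num)
  norm_num [Finset.sum_range_succ, Nat.factorial] at h3
  have h4 := (abs_le.1 h3).1
  have h5 : x ^ 2 = z ^ 2 * (1 - z / 4) ^ 2 := by rw [hx]; ring
  have h6 : (15 / 16) ^ 2 * z ^ 2 ≤ x ^ 2 := by
    rw [h5, mul_comm]
    exact mul_le_mul_of_nonneg_left (by nlinarith) (sq_nonneg z)
  have h7 : |x| ≤ 17 / 64 := by rw [abs_le]; constructor <;> nlinarith
  have h8 : |x| ^ 3 ≤ 17 / 64 * x ^ 2 := by
    have : |x| ^ 3 = |x| * x ^ 2 := by rw [← sq_abs x]; ring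
    rw [this]; exact mul_le_mul_of_nonneg_right h7 (sq_nonneg x)
  have h9 : x ^ 2 ≤ 2 * z ^ 2 := by
    rw [h5, mul_comm]
    exact mul_le_mul_of_nonneg_right (by nlinarith) (sq_nonneg z)
  nlinarith [sq_nonneg z]

/-- Bernoulli's inequality in the form that controls a change of learning rate. -/
theorem rpow_le_add_inv_sub_one {x e : ℝ} (hx : 0 ≤ x) (he : 0 < e) (he1 : e ≤ 1) :
    x ^ e ≤ x + (e⁻¹ - 1) := by
  have h1 := one_add_mul_self_le_rpow_one_add (s := x ^ e - 1)
    (by linarith [Real.rpow_nonneg hx e]) (p := e⁻¹) ((one_le_inv₀ he).2 he1)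
  have h2 : (1 + (x ^ e - 1)) ^ e⁻¹ = x := by
    rw [add_sub_cancel, ← Real.rpow_mul hx, mul_inv_cancel₀ he.ne', Real.rpow_one]
  rw [h2] at h1
  have h3 : 1 ≤ e⁻¹ := (one_le_inv₀ he).2 he1
  have h4 := Real.rpow_nonneg hx e
  nlinarith

theorem log_one_add_le_mul_add {x e : ℝ} (hx : 0 ≤ x) (he : 0 < e) :
    Real.log (1 + x) ≤ e * (1 + x) - 1 - Real.log e := by
  have h := Real.log_le_sub_one_of_pos (x := e * (1 + x)) (by positivity)
  rw [Real.log_mul he.ne' (by positivity)] at h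
  linarith

/-- A self-bounding inequality of square-root type determines its solution up to a constant. -/
theorem le_of_le_mul_sqrt {r L Λ C c : ℝ} (hC : 0 ≤ C) (hc : 0 ≤ c) (hr : 0 ≤ r) (hL : 0 ≤ L)
    (hΛ : 1 ≤ Λ) (h : r ≤ C * (√(Λ * (1 + c * (L + r))) + Λ)) :
    r ≤ 2 * C * (2 + C * c + √c) * (√(Λ * L) + Λ) := by
  have hΛ0 : 0 ≤ Λ := by linarith
  have h1 : √(Λ * (1 + c * (L + r))) ≤ √c * √(Λ * L) + Λ + √(c * Λ * r) := by
    have e1 : Λ * (1 + c * (L + r)) = c * (Λ * L) + Λ + c * Λ * r := by ring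
    rw [e1, ← Real.sqrt_mul hc]
    refine (Real.sqrt_le_iff).2 ⟨by positivity, ?_⟩
    have a1 := Real.sq_sqrt (x := c * (Λ * L)) (by positivity)
    have a2 := Real.sq_sqrt (x := c * Λ * r) (by positivity)
    have a3 := Real.sqrt_nonneg (c * (Λ * L))
    have a4 := Real.sqrt_nonneg (c * Λ * r)
    nlinarith [mul_nonneg a3 a4, mul_nonneg a3 hΛ0, mul_nonneg a4 hΛ0]
  have h2 : C * √(c * Λ * r) ≤ r / 2 + C ^ 2 * c * Λ / 2 := by
    have a2 := Real.sqrt_nonneg (c * Λ * r)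
    apply le_of_sq_le_sq _ (by positivity)
    rw [mul_pow, Real.sq_sqrt (by positivity)]
    nlinarith [sq_nonneg (r / 2 - C ^ 2 * c * Λ / 2)]
  have a5 := Real.sqrt_nonneg (Λ * L)
  have a6 := Real.sqrt_nonneg c
  have h3 : r ≤ 2 * C * (√c * √(Λ * L) + 2 * Λ) + C ^ 2 * c * Λ := by
    nlinarith [mul_le_mul_of_nonneg_left h1 hC]
  have p1 := mul_nonneg hC a5
  have p2 := mul_nonneg p1 (mul_nonneg hC hc)
  have p3 := mul_nonneg (mul_nonneg hC hΛ0) a6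
  have p4 : 0 ≤ C ^ 2 * c * Λ := by positivity
  nlinarith

/-- A self-bounding inequality of logarithmic type determines its solution up to a constant. -/
theorem le_of_le_log {r L κ C c : ℝ} (d : ℕ) (hC : 0 < C) (hc : 0 < c) (hr : 0 ≤ r) (hL : 0 ≤ L)
    (hκ : 1 ≤ κ) (h : r ≤ C * (κ + d * Real.log (1 + c * (L + r) / d))) :
    r ≤ 2 * C * (1 + c + |Real.log (2 * C * c)|) * (κ + d * (1 + Real.log (1 + L))) := by
  have hlog : 0 ≤ Real.log (1 + L) := Real.log_nonneg (by linarith)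
  set E := |Real.log (2 * C * c)| with hE
  have hE0 : 0 ≤ E := abs_nonneg _
  rcases Nat.eq_zero_or_pos d with rfl | hd
  · simp only [Nat.cast_zero, zero_mul, add_zero] at h ⊢
    have : 0 ≤ C * κ := by positivity
    nlinarith [mul_nonneg this hc.le, mul_nonneg this hE0]
  have hd1 : (1 : ℝ) ≤ d := by exact_mod_cast hd
  have hd0 : (0 : ℝ) < d := by linarith
  have h1 : 1 + c * (L + r) / d ≤ (1 + c) * (1 + L) * (1 + c * r / d) := by
    have e : c * (L + r) / d = c * L / d + c * r / d := by ring
    have e1 : c * L / d ≤ c * L := div_le_self (by positivity) hd1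
    have e2 : 0 ≤ c * r / d := by positivity
    have e3 : 0 ≤ c * L := by positivity
    rw [e]
    nlinarith [mul_nonneg e3 e2, mul_nonneg hL e2, mul_nonneg hc.le e2]
  have h2 : Real.log (1 + c * (L + r) / d) ≤ c + Real.log (1 + L) + Real.log (1 + c * r / d) := by
    refine (Real.log_le_log (by positivity) h1).trans ?_
    rw [Real.log_mul (by positivity) (by positivity), Real.log_mul (by positivity) (by positivity)]
    have := Real.log_le_sub_one_of_pos (x := 1 + c) (by positivity)
    linarith
  -- The slope is chosen so that the linear term is absorbed by half of the left-hand side.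
  have h3 := log_one_add_le_mul_add (x := c * r / d) (by positivity)
    (e := (2 * C * c)⁻¹) (by positivity)
  rw [Real.log_inv] at h3
  have h4 : (2 * C * c)⁻¹ * (1 + c * r / d) = (2 * C * c)⁻¹ + r / (2 * C * d) := by
    field_simp
  -- When `2 C c < 1` the constant term of that line is large, and the bound `log (1 + x) ≤ x` is
  -- better.
  have h5 : Real.log (1 + c * r / d) ≤ r / (2 * C * d) + E := by
    rcases le_or_gt 1 (2 * C * c) with h6 | h6
    · have := inv_le_one_of_one_le₀ h6
      have := le_abs_self (Real.log (2 * C * c))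
      linarith
    · have e1 := Real.log_le_sub_one_of_pos (x := 1 + c * r / d) (by positivity)
      have e2 : c * r / d ≤ r / (2 * C * d) := by
        rw [div_le_div_iff₀ hd0 (by positivity)]
        nlinarith [mul_le_mul_of_nonneg_left h6.le (mul_nonneg hr hd0.le)]
      linarith
  have h6 : d * Real.log (1 + c * (L + r) / d)
      ≤ d * (c + Real.log (1 + L) + E) + r / (2 * C) := by
    have e : (d : ℝ) * (r / (2 * C * d)) = r / (2 * C) := by field_simp
    nlinarith [mul_le_mul_of_nonneg_left (h2.trans (add_le_add_right h5 _)) hd0.le]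
  have h7 : C * (r / (2 * C)) = r / 2 := by field_simp
  have h8 : r ≤ 2 * C * (κ + d * (c + Real.log (1 + L) + E)) := by
    nlinarith [mul_le_mul_of_nonneg_left h6 hC.le]
  refine h8.trans ?_
  rw [mul_assoc (2 * C)]
  apply mul_le_mul_of_nonneg_left _ (by positivity)
  have q1 : 0 ≤ (d : ℝ) * Real.log (1 + L) := by positivity
  have q2 : 0 ≤ (c + E) * κ := by positivity
  have q3 : 0 ≤ (c + E) * (d * Real.log (1 + L)) := by positivity
  nlinarith

/-! ### First-order conditions and smoothness -/

theorem ConvexOn.fderiv_le_sub {E : Type*} [NormedAddCommGroup E] [NormedSpace ℝ E] {X : Set E}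
    {f : E → ℝ} {f' : E →L[ℝ] ℝ} {x y : E} (hf : ConvexOn ℝ X f) (hx : x ∈ X) (hy : y ∈ X)
    (hd : HasFDerivAt f f' x) : f' (y - x) ≤ f y - f x := by
  have h1 := (hd.hasLineDerivAt (y - x)).tendsto_slope_zero_right
  refine le_of_tendsto h1 ?_
  filter_upwards [Ioc_mem_nhdsGT (zero_lt_one' ℝ)] with s hs
  have h2 := hf.2 hx hy (sub_nonneg.2 hs.2) hs.1.le (sub_add_cancel 1 s)
  have h3 : (1 - s) • x + s • y = x + s • (y - x) := by module
  rw [h3] at h2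
  simp only [smul_eq_mul] at h2 ⊢
  rw [inv_mul_le_iff₀ hs.1]
  linarith

section

variable {d : ℕ}

theorem convexOn_gradient_inequality {X : Set (Vec d)} {f : Vec d → ℝ} {x y : Vec d}
    (hf : ConvexOn ℝ X f) (hx : x ∈ X) (hy : y ∈ X) (hd : DifferentiableAt ℝ f x) :
    f x - f y ≤ inner ℝ (gradient f x) (x - y) := by
  have h := hf.fderiv_le_sub hx hy hd.hasGradientAt.hasFDerivAt
  rw [InnerProductSpace.toDual_apply_apply] at h
  rw [← neg_sub y x, inner_neg_right]
  linarith

/-- The lower quadratic model of an `α`-exp-concave function, for any smaller modulus `c` that is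
also small compared with the range of the linear term. -/
theorem IsExpConcaveOn.sub_le {X : Set (Vec d)} {f : Vec d → ℝ} {x y : Vec d} {α c : ℝ}
    (hf : IsExpConcaveOn f α X) (hx : x ∈ X) (hy : y ∈ X) (hd : DifferentiableAt ℝ f x)
    (hc : 0 < c) (hcα : c ≤ α) (hu : c * |inner ℝ (gradient f x) (x - y)| ≤ 1 / 4) :
    f x - f y ≤ inner ℝ (gradient f x) (x - y)
      - c / 4 * (inner ℝ (gradient f x) (x - y)) ^ 2 := by
  set u := (inner ℝ (gradient f x) (x - y) : ℝ) with hu'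
  have hα : 0 < α := hc.trans_le hcα
  have hfd := hd.hasGradientAt.hasFDerivAt
  have h1 := (neg_convexOn_iff.2 hf).fderiv_le_sub hx hy ((hfd.const_mul (-α)).exp.neg)
  have h2 : inner ℝ (gradient f x) (y - x) = -u := by
    rw [hu', ← inner_neg_right, neg_sub]
  simp only [neg_apply, smul_apply,
    InnerProductSpace.toDual_apply_apply, h2, smul_eq_mul, Pi.neg_apply] at h1
  have h3 : Real.exp (α * (f x - f y)) ≤ 1 + α * u := by
    have e1 : Real.exp (α * (f x - f y)) = Real.exp (-α * f y) / Real.exp (-α * f x) := by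
      rw [← Real.exp_sub]; ring_nf
    rw [e1, div_le_iff₀ (Real.exp_pos _)]
    linarith
  have h4 : Real.exp (c * (f x - f y)) ≤ 1 + c * u := by
    have hb := rpow_one_add_le_one_add_mul_self (s := α * u)
      (by linarith [Real.exp_pos (α * (f x - f y))]) (p := c / α) (by positivity)
      ((div_le_one hα).2 hcα)
    have e2 : c / α * (α * u) = c * u := by field_simp
    rw [e2] at hb
    refine le_trans ?_ hb
    refine le_trans (le_of_eq ?_) (Real.rpow_le_rpow (Real.exp_pos _).le h3 (by positivity))
    rw [← Real.exp_mul]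
    congr 1
    field_simp
  have hcu : |c * u| ≤ 1 / 4 := by rwa [abs_mul, abs_of_pos hc]
  have h5 := (Real.le_log_iff_exp_le (by linarith [(abs_le.1 hcu).1])).2 h4
  have h6 := log_one_add_le_sub_sq hcu
  have h7 : c * (f x - f y) ≤ c * (u - c / 4 * u ^ 2) := by nlinarith
  exact le_of_mul_le_mul_left h7 hc

/-- A nonnegative smooth function has a small gradient where it is small.  It decreases along the
gradient step of length `‖∇f x‖ / (2 H)`, and the result is still nonnegative. -/
theorem IsAdmissibleLoss.norm_gradient_sq_le {X : Set (Vec d)} {f : Vec d → ℝ} {G H : ℝ}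
    (hH : 0 < H) (hG : 0 < G) (hf : IsAdmissibleLoss f X G H) {x : Vec d} (hx : x ∈ X) :
    ‖gradient f x‖ ^ 2 ≤ 4 * H * f x := by
  set v := gradient f x with hv
  have hvG : ‖v‖ ≤ G := hf.grad_le x hx
  have hmem : ∀ s : ℝ, 0 ≤ s → s ≤ 1 → x - (s / (2 * H)) • v ∈ Metric.cthickening (G / H) X := by
    intro s hs0 hs1
    refine Metric.mem_cthickening_of_dist_le _ x _ _ hx ?_
    rw [dist_eq_norm, sub_sub_cancel_left, norm_neg, norm_smul, Real.norm_of_nonneg (by positivity),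
      div_mul_eq_mul_div, div_le_div_iff₀ (by positivity) hH]
    nlinarith [mul_le_mul hs1 hvG (norm_nonneg v) zero_le_one, norm_nonneg v]
  let φ : ℝ → ℝ := fun s => f (x - (s / (2 * H)) • v)
  have hder : ∀ s ∈ Set.Icc (0 : ℝ) 1, HasDerivAt φ
      (inner ℝ (gradient f (x - (s / (2 * H)) • v)) (-(1 / (2 * H)) • v)) s := by
    intro s hs
    have h1 := (hf.smooth.1 _ (hmem s hs.1 hs.2)).hasGradientAt.hasFDerivAt
    have h2 : HasDerivAt (fun s : ℝ => x - (s / (2 * H)) • v) (-(1 / (2 * H)) • v) s := by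
      rw [neg_smul]
      exact (((hasDerivAt_id s).div_const (2 * H)).smul_const v).const_sub x
    have h3 := h1.comp_hasDerivAt s h2
    rwa [InnerProductSpace.toDual_apply_apply] at h3
  obtain ⟨c, hc, hceq⟩ := exists_hasDerivAt_eq_slope φ _ zero_lt_one
    (fun s hs => (hder s hs).continuousAt.continuousWithinAt)
    (fun s hs => hder s ⟨hs.1.le, hs.2.le⟩)
  have h0 : φ 0 = f x := by simp [φ]
  have h1 : 0 ≤ φ 1 := hf.nonneg _ (hmem 1 zero_le_one le_rfl)
  rw [h0, sub_zero, div_one, inner_smul_right] at hceq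
  set w := gradient f (x - (c / (2 * H)) • v) with hw
  have hlip : ‖w - v‖ ≤ 1 / 2 * ‖v‖ := by
    have h := hf.smooth.2 _ (hmem c hc.1.le hc.2.le) x (Metric.self_subset_cthickening _ hx)
    rw [sub_sub_cancel_left, norm_neg, norm_smul, Real.norm_of_nonneg (by have := hc.1; positivity)]
      at h
    refine h.trans ?_
    have e : H * (c / (2 * H) * ‖v‖) = c / 2 * ‖v‖ := by field_simp
    rw [e]
    have := hc.2
    gcongr
  have hin : (1 / 2) * ‖v‖ ^ 2 ≤ inner ℝ w v := by
    have e : inner ℝ w v = ‖v‖ ^ 2 + inner ℝ (w - v) v := by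
      rw [inner_sub_left, real_inner_self_eq_norm_sq]; ring
    have e2 := (abs_le.1 (abs_real_inner_le_norm (w - v) v)).1
    nlinarith [mul_le_mul_of_nonneg_right hlip (norm_nonneg v)]
  have h2 : inner ℝ w v ≤ 2 * H * f x := by
    have e : 2 * H * (-(1 / (2 * H)) * inner ℝ w v) = -inner ℝ w v := by field_simp
    nlinarith
  linarith

theorem IsAdmissibleLoss.differentiableAt {X : Set (Vec d)} {f : Vec d → ℝ} {G H : ℝ}
    (hf : IsAdmissibleLoss f X G H) {x : Vec d} (hx : x ∈ X) : DifferentiableAt ℝ f x :=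
  hf.smooth.1 x (Metric.self_subset_cthickening _ hx)

/-! ### Projections and the surrogate gradient -/

theorem IsProjectionOnto.inner_nonneg {P : Vec d → Vec d} {X : Set (Vec d)}
    (hP : IsProjectionOnto P X) (hX : Convex ℝ X) (y : Vec d) {x : Vec d} (hx : x ∈ X) :
    0 ≤ inner ℝ (y - P y) (P y - x) := by
  refine nonneg_of_forall_quadratic (c := ‖P y - x‖ ^ 2) fun s hs0 hs1 => ?_
  have h1 : P y + s • (x - P y) ∈ X := hX.add_smul_sub_mem (hP y).1 hx ⟨hs0.le, hs1⟩
  have h2 := (hP y).2 _ h1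
  have h3 : y - (P y + s • (x - P y)) = (y - P y) + s • (P y - x) := by module
  rw [h3] at h2
  have h4 := pow_le_pow_left₀ (norm_nonneg _) h2 2
  rw [norm_add_sq_real, inner_smul_right, norm_smul, mul_pow, Real.norm_eq_abs, sq_abs] at h4
  linarith

theorem norm_surrGrad_le (y x v : Vec d) : ‖surrGrad y x v‖ ≤ ‖v‖ := by
  unfold surrGrad
  set w : Vec d := ‖y - x‖⁻¹ • (y - x) with hw
  have hw1 : ‖w‖ ^ 2 ≤ 1 := by
    rw [hw, norm_smul, norm_inv, norm_norm]
    exact pow_le_one₀ (by positivity) (inv_mul_le_one)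
  simp only
  split_ifs with h
  · refine le_of_sq_le_sq ?_ (norm_nonneg _)
    rw [norm_sub_sq_real, inner_smul_right, norm_smul, mul_pow, Real.norm_eq_abs, sq_abs]
    nlinarith [sq_nonneg (inner ℝ v w : ℝ)]
  · rfl

/-- The surrogate gradient points away from the domain, if it does not vanish in that direction. -/
theorem inner_surrGrad_nonneg (y x v : Vec d) : 0 ≤ inner ℝ (surrGrad y x v) (y - x) := by
  unfold surrGrad
  set w : Vec d := ‖y - x‖⁻¹ • (y - x) with hw
  have hyx : y - x = ‖y - x‖ • w := by
    rcases eq_or_ne (y - x) 0 with h | h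
    · simp [h]
    · rw [hw, smul_smul, mul_inv_cancel₀ (norm_ne_zero_iff.2 h), one_smul]
  simp only
  split_ifs with h
  · have hw1 : inner ℝ w (y - x) = ‖y - x‖ := by
      rw [hw, inner_smul_left, real_inner_self_eq_norm_sq]
      rcases eq_or_ne (y - x) 0 with h | h
      · simp [h]
      · have := norm_ne_zero_iff.2 h
        simp only [conj_trivial]; field_simp
    rw [inner_sub_left, inner_smul_left, hw1]
    conv_rhs => rw [hyx, inner_smul_right]
    simp only [conj_trivial]
    rw [mul_comm, ← hyx]
    simp
  · rw [hyx, inner_smul_right]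
    exact mul_nonneg (norm_nonneg _) (not_lt.1 h)

/-- Passing to the surrogate gradient does not decrease the linearized regret. -/
theorem inner_le_inner_surrGrad {P : Vec d → Vec d} {X : Set (Vec d)}
    (hP : IsProjectionOnto P X) (hX : Convex ℝ X) (y v : Vec d) {x : Vec d} (hx : x ∈ X) :
    inner ℝ v (P y - x) ≤ inner ℝ (surrGrad y (P y) v) (P y - x) := by
  have h1 := hP.inner_nonneg hX y hx
  unfold surrGrad
  simp only
  split_ifs with h
  · rw [inner_sub_left, inner_smul_left]
    simp only [conj_trivial]
    have h2 : 0 ≤ inner ℝ (‖y - P y‖⁻¹ • (y - P y)) (P y - x) := by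
      rw [inner_smul_left]; simp only [conj_trivial]; positivity
    nlinarith
  · rfl

theorem norm_ballClip_le {D : ℝ} (hD : 0 ≤ D) (z : Vec d) : ‖ballClip D z‖ ≤ D := by
  unfold ballClip
  split_ifs with h
  · exact h
  · have hz : 0 < ‖z‖ := by linarith
    rw [norm_smul, Real.norm_of_nonneg (by positivity), div_mul_cancel₀ _ hz.ne']

theorem norm_ballClip_sub_sq_le {D : ℝ} (hD : 0 ≤ D) (z : Vec d) {x : Vec d} (hx : ‖x‖ ≤ D) :
    ‖ballClip D z - x‖ ^ 2 ≤ ‖z - x‖ ^ 2 := by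
  unfold ballClip
  split_ifs with h
  · rfl
  · have hz : 0 < ‖z‖ := by linarith
    have hr : D / ‖z‖ ≤ 1 := by rw [div_le_one hz]; linarith
    have h1 : inner ℝ z x ≤ ‖z‖ * D :=
      (real_inner_le_norm z x).trans (mul_le_mul_of_nonneg_left hx hz.le)
    rw [norm_sub_sq_real, norm_sub_sq_real, norm_smul, inner_smul_left,
      Real.norm_of_nonneg (by positivity), div_mul_cancel₀ _ hz.ne']
    simp only [conj_trivial]
    have h2 := mul_le_mul_of_nonneg_left h1 (sub_nonneg.2 hr)
    have h3 : (1 - D / ‖z‖) * (‖z‖ * D) = D * ‖z‖ - D ^ 2 := by field_simp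
    nlinarith [sq_nonneg (‖z‖ - D)]

/-! ### Gradient descent experts -/

theorem inner_le_of_ballClip {D η : ℝ} (hD : 0 ≤ D) (y h : Vec d) {x : Vec d} (hx : ‖x‖ ≤ D) :
    2 * η * inner ℝ h (y - x)
      ≤ ‖y - x‖ ^ 2 - ‖ballClip D (y - η • h) - x‖ ^ 2 + η ^ 2 * ‖h‖ ^ 2 := by
  have h1 := norm_ballClip_sub_sq_le hD (y - η • h) hx
  have h2 : y - η • h - x = (y - x) - η • h := by abel
  rw [h2, norm_sub_sq_real (y - x), inner_smul_right, norm_smul, mul_pow, Real.norm_eq_abs, sq_abs,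
    real_inner_comm] at h1
  linarith

theorem norm_sub_sq_le_four_mul {D : ℝ} {x y : Vec d} (hx : ‖x‖ ≤ D) (hy : ‖y‖ ≤ D) :
    ‖x - y‖ ^ 2 ≤ 4 * D ^ 2 := by
  have h := (norm_sub_le x y).trans (add_le_add hx hy)
  nlinarith [norm_nonneg (x - y)]

section SOGD

variable {D a δ : ℝ} {g : ℕ → Vec d} {s : ℕ → Vec d × ℝ}

theorem sogd_snd (hs : ∀ t, s (t + 1) = sogdStep D a δ (g t) (s t)) (h0 : (s 0).2 = 0) (n : ℕ) :
    (s n).2 = ∑ t ∈ Finset.range n, ‖g t‖ ^ 2 := by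
  induction n with
  | zero => simp [h0]
  | succ n ih => rw [hs, Finset.sum_range_succ, ← ih]; rfl

theorem sogd_norm_le (hD : 0 ≤ D) (hs : ∀ t, s (t + 1) = sogdStep D a δ (g t) (s t))
    (h1 : ‖(s 0).1‖ ≤ D) (n : ℕ) : ‖(s n).1‖ ≤ D := by
  cases n with
  | zero => exact h1
  | succ n => rw [hs]; exact norm_ballClip_le hD _

/-- Scale-free gradient descent has regret of the order of the root of the sum of the squared
norms of the gradients. -/
theorem sogd_regret_le (hD : 0 ≤ D) (ha : 0 < a) (hδ : 0 < δ)
    (hs : ∀ t, s (t + 1) = sogdStep D a δ (g t) (s t)) (h0 : (s 0).2 = 0) (h1 : ‖(s 0).1‖ ≤ D)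
    {x : Vec d} (hx : ‖x‖ ≤ D) (n : ℕ) :
    ∑ t ∈ Finset.range n, inner ℝ (g t) ((s t).1 - x)
      ≤ (2 * D ^ 2 / a + a) * √(δ + ∑ t ∈ Finset.range n, ‖g t‖ ^ 2) := by
  suffices h : ∑ t ∈ Finset.range n, inner ℝ (g t) ((s t).1 - x)
      + ‖(s n).1 - x‖ ^ 2 * √(δ + ∑ t ∈ Finset.range n, ‖g t‖ ^ 2) / (2 * a)
      ≤ (2 * D ^ 2 / a + a) * √(δ + ∑ t ∈ Finset.range n, ‖g t‖ ^ 2) by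
    have : 0 ≤ ‖(s n).1 - x‖ ^ 2 * √(δ + ∑ t ∈ Finset.range n, ‖g t‖ ^ 2) / (2 * a) := by positivity
    linarith
  induction n with
  | zero =>
    have h2 := norm_sub_sq_le_four_mul h1 hx
    simp only [Finset.range_zero, Finset.sum_empty, zero_add, add_zero]
    have e : ‖(s 0).1 - x‖ ^ 2 * √δ / (2 * a) ≤ 4 * D ^ 2 * √δ / (2 * a) := by gcongr
    have e2 : 4 * D ^ 2 * √δ / (2 * a) = 2 * D ^ 2 / a * √δ := by field_simp; ring
    have : 0 ≤ a * √δ := by positivity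
    linarith
  | succ n ih =>
    have hsnd := sogd_snd hs h0 n
    set S := ∑ t ∈ Finset.range n, ‖g t‖ ^ 2 with hS
    have hS0 : 0 ≤ S := Finset.sum_nonneg fun _ _ => by positivity
    have h2 := norm_sub_sq_le_four_mul (sogd_norm_le hD hs h1 n) hx
    rw [Finset.sum_range_succ, Finset.sum_range_succ, ← hS, ← add_assoc]
    set q := √(δ + S) with hq
    set q' := √(δ + S + ‖g n‖ ^ 2) with hq'
    have hqpos : 0 < q := Real.sqrt_pos.2 (by positivity)
    have hqq : q ≤ q' := Real.sqrt_le_sqrt (by linarith [sq_nonneg ‖g n‖])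
    have hq'pos : 0 < q' := by linarith
    have hqs : q ^ 2 = δ + S := Real.sq_sqrt (by positivity)
    have hqs' : q' ^ 2 = δ + S + ‖g n‖ ^ 2 := Real.sq_sqrt (by positivity)
    have h3 := inner_le_of_ballClip (η := a / q') hD (s n).1 (g n) hx
    have h4 : (s (n + 1)).1 = ballClip D ((s n).1 - (a / q') • g n) := by
      rw [hs, hq', add_assoc, ← hsnd]; rfl
    rw [← h4] at h3
    have h5 : inner ℝ (g n) ((s n).1 - x) ≤
        (‖(s n).1 - x‖ ^ 2 - ‖(s (n + 1)).1 - x‖ ^ 2) * q' / (2 * a)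
          + a * ‖g n‖ ^ 2 / (2 * q') := by
      have e : inner ℝ (g n) ((s n).1 - x)
          = (2 * (a / q') * inner ℝ (g n) ((s n).1 - x)) * (q' / (2 * a)) := by
        field_simp
      have e2 : (‖(s n).1 - x‖ ^ 2 - ‖(s (n + 1)).1 - x‖ ^ 2) * q' / (2 * a)
          + a * ‖g n‖ ^ 2 / (2 * q') = (‖(s n).1 - x‖ ^ 2 - ‖(s (n + 1)).1 - x‖ ^ 2
          + (a / q') ^ 2 * ‖g n‖ ^ 2) * (q' / (2 * a)) := by
        field_simp
      rw [e, e2]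
      exact mul_le_mul_of_nonneg_right h3 (by positivity)
    have h6 : a * ‖g n‖ ^ 2 / (2 * q') ≤ a * (q' - q) := by
      rw [div_le_iff₀ (by positivity)]
      have : ‖g n‖ ^ 2 = (q' - q) * (q' + q) := by linarith
      rw [this]
      nlinarith [mul_nonneg ha.le (mul_nonneg (sub_nonneg.2 hqq) (sub_nonneg.2 hqq))]
    have h7 : ‖(s n).1 - x‖ ^ 2 * (q' - q) / (2 * a) ≤ 2 * D ^ 2 / a * (q' - q) := by
      have e : 2 * D ^ 2 / a * (q' - q) = 4 * D ^ 2 * (q' - q) / (2 * a) := by field_simp; ring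
      rw [e]
      have := sub_nonneg.2 hqq
      gcongr
    have e1 : (‖(s n).1 - x‖ ^ 2 - ‖(s (n + 1)).1 - x‖ ^ 2) * q' / (2 * a)
        = ‖(s n).1 - x‖ ^ 2 * q / (2 * a) + ‖(s n).1 - x‖ ^ 2 * (q' - q) / (2 * a)
          - ‖(s (n + 1)).1 - x‖ ^ 2 * q' / (2 * a) := by ring
    linarith

end SOGD

section S2OGD

variable {D G mu : ℝ} {g xt : ℕ → Vec d} {s : ℕ → Vec d × ℝ}

theorem s2ogd_snd (hs : ∀ t, s (t + 1) = s2ogdStep D G mu (g t) (xt t) (s t)) (h0 : (s 0).2 = 0)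
    (n : ℕ) : (s n).2 = ∑ t ∈ Finset.range n, ‖scGrad mu G (g t) (xt t) (s t).1‖ ^ 2 := by
  induction n with
  | zero => simp [h0]
  | succ n ih => rw [hs, Finset.sum_range_succ, ← ih]; rfl

theorem s2ogd_norm_le (hD : 0 ≤ D) (hs : ∀ t, s (t + 1) = s2ogdStep D G mu (g t) (xt t) (s t))
    (h1 : ‖(s 0).1‖ ≤ D) (n : ℕ) : ‖(s n).1‖ ≤ D := by
  cases n with
  | zero => exact h1
  | succ n => rw [hs]; exact norm_ballClip_le hD _

theorem norm_scGrad_le (hG : 0 < G) (hmu : 0 ≤ mu) (hmu1 : mu ≤ 1) {g x y : Vec d}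
    (hg : ‖g‖ ≤ G) (hx : ‖x‖ ≤ D) (hy : ‖y‖ ≤ D) :
    ‖scGrad mu G g x y‖ ≤ (1 + 2 * D / G) * ‖g‖ := by
  unfold scGrad
  refine (norm_add_le _ _).trans ?_
  rw [norm_smul, Real.norm_of_nonneg (by positivity)]
  have h1 : ‖y - x‖ ≤ 2 * D := by linarith [norm_sub_le y x]
  have h2 : mu / G ^ 2 * ‖g‖ ^ 2 * ‖y - x‖ ≤ 1 / G ^ 2 * (G * ‖g‖) * (2 * D) := by
    rw [sq ‖g‖]
    gcongr
  have h3 : 1 / G ^ 2 * (G * ‖g‖) * (2 * D) = 2 * D / G * ‖g‖ := by field_simp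
  linarith

theorem scLoss_sub (g yt xt x y : Vec d) :
    scLoss mu G g yt xt y - scLoss mu G g yt xt x
      = inner ℝ (scGrad mu G g xt y) (y - x) - mu / (2 * G ^ 2) * ‖g‖ ^ 2 * ‖y - x‖ ^ 2 := by
  unfold scLoss scGrad
  have e1 : x - xt = (y - xt) - (y - x) := by abel
  have e2 : inner ℝ g (x - yt) = inner ℝ g (y - yt) - inner ℝ g (y - x) := by
    rw [← inner_sub_right]; congr 1; abel
  rw [e1, norm_sub_sq_real (y - xt) (y - x), e2, inner_add_left, inner_smul_left]
  simp only [conj_trivial]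
  ring

/-- The regret of a strongly convex expert is logarithmic in the sum of the squared norms of the
surrogate gradients; the modulus `mu` inside the logarithm comes from the step size. -/
theorem s2ogd_regret_le (hD : 0 < D) (hG : 0 < G) (hmu : 0 < mu) (hmu1 : mu ≤ 1)
    (hs : ∀ t, s (t + 1) = s2ogdStep D G mu (g t) (xt t) (s t)) (h0 : (s 0).2 = 0)
    (h1 : ‖(s 0).1‖ ≤ D) {x : Vec d} (hx : ‖x‖ ≤ D) (yt : ℕ → Vec d) (n : ℕ)
    (hg : ∀ t < n, ‖g t‖ ≤ G) (hxt : ∀ t < n, ‖xt t‖ ≤ D) :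
    ∑ t ∈ Finset.range n, (scLoss mu G (g t) (yt t) (xt t) (s t).1
        - scLoss mu G (g t) (yt t) (xt t) x)
      ≤ 2 * D ^ 2 * (1 + 2 * D / G) ^ 2 + (G + 2 * D) ^ 2 / (2 * mu)
        * Real.log (1 + mu / (G + 2 * D) ^ 2 * ∑ t ∈ Finset.range n, ‖g t‖ ^ 2) := by
  set A := (G + 2 * D) ^ 2 / mu with hA
  set B := (1 + 2 * D / G) ^ 2 with hB
  have hApos : 0 < A := by positivity
  have hBpos : 0 < B := by positivity
  have hpos : ∀ m, 0 < B * A + (s m).2 := fun m => by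
    have : 0 ≤ (s m).2 := by
      rw [s2ogd_snd hs h0]; exact Finset.sum_nonneg fun _ _ => by positivity
    positivity
  have key : ∑ t ∈ Finset.range n, (scLoss mu G (g t) (yt t) (xt t) (s t).1
        - scLoss mu G (g t) (yt t) (xt t) x)
      + ‖(s n).1 - x‖ ^ 2 * (B * A + (s n).2) / (2 * A)
      ≤ 2 * D ^ 2 * B + A / 2 * (Real.log (B * A + (s n).2) - Real.log (B * A)) := by
    clear hB
    induction n with
    | zero =>
      have h2 := norm_sub_sq_le_four_mul h1 hx
      simp only [Finset.range_zero, Finset.sum_empty, zero_add, h0, add_zero, sub_self, mul_zero]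
      rw [div_le_iff₀ (by positivity)]
      nlinarith [mul_pos hBpos hApos]
    | succ n ih =>
      have ih := ih (fun t ht => hg t (by omega)) (fun t ht => hxt t (by omega))
      rw [Finset.sum_range_succ, scLoss_sub]
      have hgn := norm_scGrad_le hG hmu.le hmu1 (hg n (by omega)) (hxt n (by omega))
        (s2ogd_norm_le hD.le hs h1 n)
      set h := scGrad mu G (g n) (xt n) (s n).1 with hh
      set S := B * A + (s n).2 with hS
      set S' := B * A + (s (n + 1)).2 with hS'
      have hSS : S' = S + ‖h‖ ^ 2 := by
        rw [hS', hS, hs]; simp only [s2ogdStep]; rw [← hh]; ring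
      have hSpos : 0 < S := hpos n
      have hS'pos : 0 < S' := hpos (n + 1)
      have h3 := inner_le_of_ballClip (η := A / S') hD.le (s n).1 h hx
      have h4 : (s (n + 1)).1 = ballClip D ((s n).1 - (A / S') • h) := by
        rw [hS']
        simp only [hs, s2ogdStep]
        rfl
      rw [← h4] at h3
      have h5 : inner ℝ h ((s n).1 - x) ≤
          (‖(s n).1 - x‖ ^ 2 - ‖(s (n + 1)).1 - x‖ ^ 2) * S' / (2 * A)
            + A / 2 * (‖h‖ ^ 2 / S') := by
        have e : inner ℝ h ((s n).1 - x)
            = (2 * (A / S') * inner ℝ h ((s n).1 - x)) * (S' / (2 * A)) := by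
          field_simp
        have e2 : (‖(s n).1 - x‖ ^ 2 - ‖(s (n + 1)).1 - x‖ ^ 2) * S' / (2 * A)
            + A / 2 * (‖h‖ ^ 2 / S') = (‖(s n).1 - x‖ ^ 2 - ‖(s (n + 1)).1 - x‖ ^ 2
            + (A / S') ^ 2 * ‖h‖ ^ 2) * (S' / (2 * A)) := by
          field_simp
        rw [e, e2]
        exact mul_le_mul_of_nonneg_right h3 (by positivity)
      have h6 : ‖h‖ ^ 2 / S' ≤ Real.log S' - Real.log S := by
        rw [← Real.log_div hS'pos.ne' hSpos.ne']
        refine le_trans (le_of_eq ?_) (Real.one_sub_inv_le_log_of_pos (by positivity))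
        rw [inv_div, one_sub_div hS'pos.ne', hSS]; ring_nf
      -- The increase of the inverse step size is paid by the strong convexity of the loss.
      have h7 : ‖h‖ ^ 2 / (2 * A) ≤ mu / (2 * G ^ 2) * ‖g n‖ ^ 2 := by
        rw [div_le_iff₀ (by positivity), hA]
        refine (pow_le_pow_left₀ (norm_nonneg _) hgn 2).trans (le_of_eq ?_)
        field_simp
      have h8 := mul_le_mul_of_nonneg_left h7 (sq_nonneg ‖(s n).1 - x‖)
      have e1 : (‖(s n).1 - x‖ ^ 2 - ‖(s (n + 1)).1 - x‖ ^ 2) * S' / (2 * A)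
          = ‖(s n).1 - x‖ ^ 2 * S / (2 * A) + ‖(s n).1 - x‖ ^ 2 * (‖h‖ ^ 2 / (2 * A))
            - ‖(s (n + 1)).1 - x‖ ^ 2 * S' / (2 * A) := by rw [hSS]; ring
      have h9 := mul_le_mul_of_nonneg_left h6 (half_pos hApos).le
      linarith
  have h2 : 0 ≤ ‖(s n).1 - x‖ ^ 2 * (B * A + (s n).2) / (2 * A) := by
    have := (hpos n).le; positivity
  have h3 : Real.log (B * A + (s n).2) - Real.log (B * A)
      ≤ Real.log (1 + mu / (G + 2 * D) ^ 2 * ∑ t ∈ Finset.range n, ‖g t‖ ^ 2) := by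
    rw [← Real.log_div (hpos n).ne' (by positivity)]
    refine Real.log_le_log (div_pos (hpos n) (by positivity)) ?_
    rw [div_le_iff₀ (by positivity)]
    have h4 : (s n).2 ≤ B * ∑ t ∈ Finset.range n, ‖g t‖ ^ 2 := by
      rw [s2ogd_snd hs h0, Finset.mul_sum]
      refine Finset.sum_le_sum fun t ht => ?_
      have ht' := Finset.mem_range.1 ht
      rw [hB, ← mul_pow]
      exact pow_le_pow_left₀ (norm_nonneg _) (norm_scGrad_le hG hmu.le hmu1 (hg t ht')
        (hxt t ht') (s2ogd_norm_le hD.le hs h1 t)) 2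
    have e : (1 + mu / (G + 2 * D) ^ 2 * ∑ t ∈ Finset.range n, ‖g t‖ ^ 2) * (B * A)
        = B * A + B * ∑ t ∈ Finset.range n, ‖g t‖ ^ 2 := by
      rw [hA]; field_simp
    linarith
  have h4 := mul_le_mul_of_nonneg_left h3 (half_pos hApos).le
  have e : A / 2 = (G + 2 * D) ^ 2 / (2 * mu) := by rw [hA]; field_simp
  rw [e] at h4 key
  linarith

end S2OGD

/-! ### Quadratic forms and the online Newton step -/

theorem vec_inner_eq_dotProduct (u v : Vec d) : inner ℝ u v = u.ofLp ⬝ᵥ v.ofLp := by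
  rw [EuclideanSpace.inner_eq_star_dotProduct, star_trivial, dotProduct_comm]

theorem Matrix.IsHermitian.dotProduct_mulVec_comm {M : Matrix (Fin d) (Fin d) ℝ}
    (hM : M.IsHermitian) (u v : Fin d → ℝ) : u ⬝ᵥ (M *ᵥ v) = v ⬝ᵥ (M *ᵥ u) := by
  have hT : Mᵀ = M := by simpa [Matrix.conjTranspose_eq_transpose_of_trivial] using hM.eq
  rw [Matrix.dotProduct_mulVec, ← Matrix.mulVec_transpose, hT, dotProduct_comm]

theorem Matrix.IsHermitian.quadForm_add {M : Matrix (Fin d) (Fin d) ℝ}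
    (hM : M.IsHermitian) (u v : Fin d → ℝ) :
    (u + v) ⬝ᵥ (M *ᵥ (u + v)) = u ⬝ᵥ (M *ᵥ u) + 2 * (u ⬝ᵥ (M *ᵥ v)) + v ⬝ᵥ (M *ᵥ v) := by
  rw [Matrix.mulVec_add, add_dotProduct, dotProduct_add, dotProduct_add,
    hM.dotProduct_mulVec_comm v u]
  ring

theorem quadForm_smul (M : Matrix (Fin d) (Fin d) ℝ) (c : ℝ) (v : Fin d → ℝ) :
    (c • v) ⬝ᵥ (M *ᵥ (c • v)) = c ^ 2 * (v ⬝ᵥ (M *ᵥ v)) := by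
  rw [Matrix.mulVec_smul, smul_dotProduct, dotProduct_smul, smul_eq_mul, smul_eq_mul]; ring

theorem exists_isBallNearest {D : ℝ} (hD : 0 ≤ D) (M : Matrix (Fin d) (Fin d) ℝ) (z : Vec d) :
    ∃ y, IsBallNearest D M z y := by
  have hc : Continuous fun w : Vec d => (w - z).ofLp ⬝ᵥ (M *ᵥ (w - z).ofLp) := by
    have h1 : Continuous fun w : Vec d => (w - z).ofLp := by fun_prop
    exact h1.dotProduct (continuous_const.matrix_mulVec h1)
  obtain ⟨y, hy, hmin⟩ := (isCompact_closedBall (0 : Vec d) D).exists_isMinOn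
    ⟨0, Metric.mem_closedBall_self hD⟩ hc.continuousOn
  refine ⟨y, by simpa using hy, fun w hw => hmin (by simpa using hw)⟩

theorem norm_ballProj_le {D : ℝ} (hD : 0 ≤ D) (M : Matrix (Fin d) (Fin d) ℝ) (z : Vec d) :
    ‖ballProj D M z‖ ≤ D := by
  unfold ballProj
  split_ifs with h
  · exact h
  · exact (Classical.epsilon_spec (exists_isBallNearest hD M z)).1

/-- The Pythagorean inequality for the projection in the norm given by `M`. -/
theorem IsBallNearest.quadForm_sub_le {D : ℝ} {M : Matrix (Fin d) (Fin d) ℝ}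
    (hM : M.PosSemidef) {z y : Vec d} (hy : IsBallNearest D M z y) {x : Vec d} (hx : ‖x‖ ≤ D) :
    (y - x).ofLp ⬝ᵥ (M *ᵥ (y - x).ofLp) ≤ (z - x).ofLp ⬝ᵥ (M *ᵥ (z - x).ofLp) := by
  have hq : ∀ v : Fin d → ℝ, 0 ≤ v ⬝ᵥ (M *ᵥ v) := fun v => by
    have := hM.dotProduct_mulVec_nonneg v
    rwa [star_trivial] at this
  have h1 : 0 ≤ (y - z).ofLp ⬝ᵥ (M *ᵥ (x - y).ofLp) := by
    refine nonneg_of_forall_quadratic (c := (x - y).ofLp ⬝ᵥ (M *ᵥ (x - y).ofLp))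
      fun s hs0 hs1 => ?_
    have hw : ‖y + s • (x - y)‖ ≤ D := by
      rw [← mem_closedBall_zero_iff] at hx ⊢
      exact (convex_closedBall (0 : Vec d) D).add_smul_sub_mem (mem_closedBall_zero_iff.2 hy.1) hx
        ⟨hs0.le, hs1⟩
    have h2 := hy.2 _ hw
    have e : (y + s • (x - y) - z).ofLp = (y - z).ofLp + s • (x - y).ofLp := by
      rw [add_sub_right_comm]; rfl
    rw [e, hM.isHermitian.quadForm_add, quadForm_smul, Matrix.mulVec_smul, dotProduct_smul,
      smul_eq_mul] at h2
    linarith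
  have e : (y - x).ofLp = -(x - y).ofLp := by rw [← WithLp.ofLp_neg, neg_sub]
  have e2 : (z - x).ofLp = -((y - z).ofLp + (x - y).ofLp) := by
    rw [← WithLp.ofLp_add, ← WithLp.ofLp_neg]; congr 1; abel
  rw [e, e2, Matrix.mulVec_neg, Matrix.mulVec_neg, neg_dotProduct_neg, neg_dotProduct_neg,
    hM.isHermitian.quadForm_add]
  linarith [hq (y - z).ofLp]

theorem quadForm_ballProj_sub_le {D : ℝ} (hD : 0 ≤ D) {M : Matrix (Fin d) (Fin d) ℝ}
    (hM : M.PosSemidef) (z : Vec d) {x : Vec d} (hx : ‖x‖ ≤ D) :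
    (ballProj D M z - x).ofLp ⬝ᵥ (M *ᵥ (ballProj D M z - x).ofLp)
      ≤ (z - x).ofLp ⬝ᵥ (M *ᵥ (z - x).ofLp) := by
  unfold ballProj
  split_ifs with h
  · rfl
  · exact (Classical.epsilon_spec (exists_isBallNearest hD M z)).quadForm_sub_le hM hx

theorem posSemidef_vecMulVec (h : Fin d → ℝ) : (Matrix.vecMulVec h h).PosSemidef := by
  simpa using Matrix.posSemidef_vecMulVec_self_star h

/-- The matrix determinant lemma turns the local norm of a new gradient into the increase of the
log-determinant. -/
theorem dotProduct_inv_mulVec_le_log_det {M : Matrix (Fin d) (Fin d) ℝ} (hM : M.PosDef)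
    (h : Fin d → ℝ) :
    h ⬝ᵥ ((M + Matrix.vecMulVec h h)⁻¹ *ᵥ h)
      ≤ Real.log (M + Matrix.vecMulVec h h).det - Real.log M.det := by
  have hM' : (M + Matrix.vecMulVec h h).PosDef := hM.add_posSemidef (posSemidef_vecMulVec h)
  set M' := M + Matrix.vecMulVec h h with hM'def
  have hdet := hM.det_pos
  have hdet' := hM'.det_pos
  have e1 : M = M' + Matrix.replicateCol Unit (-h) * Matrix.replicateRow Unit h := by
    rw [← Matrix.vecMulVec_eq Unit, Matrix.neg_vecMulVec, hM'def]; abel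
  have e2 : M.det = M'.det * (1 - h ⬝ᵥ (M'⁻¹ *ᵥ h)) := by
    conv_lhs => rw [e1]
    rw [Matrix.det_add_replicateCol_mul_replicateRow hdet'.ne'.isUnit, Matrix.mul_assoc,
      ← Matrix.replicateCol_mulVec, Matrix.det_unique (n := Unit), Matrix.add_apply,
      Matrix.replicateRow_mul_replicateCol_apply, Matrix.mulVec_neg, dotProduct_neg]
    simp [sub_eq_add_neg]
  rw [← Real.log_div hdet'.ne' hdet.ne']
  refine le_trans (le_of_eq ?_) (Real.one_sub_inv_le_log_of_pos (by positivity))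
  rw [inv_div, e2, mul_div_cancel_left₀ _ hdet'.ne']
  ring

/-- The arithmetic-geometric mean inequality for the eigenvalues, in logarithmic form. -/
theorem Matrix.PosDef.log_det_le {M : Matrix (Fin d) (Fin d) ℝ} (hM : M.PosDef) :
    Real.log M.det ≤ d * Real.log (M.trace / d) := by
  rcases Nat.eq_zero_or_pos d with rfl | hd
  · simp
  have hd0 : (0 : ℝ) < d := by exact_mod_cast hd
  have htr : M.trace = ∑ i, hM.isHermitian.eigenvalues i := by
    simpa using hM.isHermitian.trace_eq_sum_eigenvalues
  have hdet : M.det = ∏ i, hM.isHermitian.eigenvalues i := by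
    simpa using hM.isHermitian.det_eq_prod_eigenvalues
  have hpos := hM.eigenvalues_pos
  have : Nonempty (Fin d) := ⟨⟨0, hd⟩⟩
  have htpos : 0 < M.trace := by
    rw [htr]; exact Finset.sum_pos (fun i _ => hpos i) Finset.univ_nonempty
  set m := M.trace / d with hm
  have hmpos : 0 < m := by positivity
  rw [hdet, Real.log_prod (fun i _ => (hpos i).ne')]
  have h1 : ∀ i, Real.log (hM.isHermitian.eigenvalues i)
      ≤ Real.log m + (hM.isHermitian.eigenvalues i / m - 1) := fun i => by
    have := Real.log_le_sub_one_of_pos (div_pos (hpos i) hmpos)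
    rw [Real.log_div (hpos i).ne' hmpos.ne'] at this
    linarith
  refine (Finset.sum_le_sum fun i _ => h1 i).trans (le_of_eq ?_)
  rw [Finset.sum_add_distrib, Finset.sum_sub_distrib, ← Finset.sum_div, ← htr]
  simp only [Finset.sum_const, Finset.card_univ, Fintype.card_fin, nsmul_eq_mul, mul_one]
  have : M.trace / m = d := by rw [hm]; field_simp
  rw [this]; ring

section ONS

variable {D β : ℝ} {g yt : ℕ → Vec d} {s : ℕ → Vec d × Matrix (Fin d) (Fin d) ℝ}

theorem ons_posDef (hs : ∀ t, s (t + 1) = onsStep D β (g t) (yt t) (s t)) (h0 : (s 0).2.PosDef)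
    (n : ℕ) : (s n).2.PosDef := by
  induction n with
  | zero => exact h0
  | succ n ih => rw [hs]; exact ih.add_posSemidef (posSemidef_vecMulVec _)

theorem ons_trace (hs : ∀ t, s (t + 1) = onsStep D β (g t) (yt t) (s t)) (n : ℕ) :
    (s n).2.trace = (s 0).2.trace
      + ∑ t ∈ Finset.range n, ‖expGrad β (g t) (yt t) (s t).1‖ ^ 2 := by
  induction n with
  | zero => simp
  | succ n ih =>
    rw [hs, Finset.sum_range_succ, ← add_assoc, ← ih]
    simp only [onsStep]
    rw [Matrix.trace_add, Matrix.trace_vecMulVec, ← vec_inner_eq_dotProduct,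
      real_inner_self_eq_norm_sq]

/-- One online Newton step, compared with a point `x` of the ball. -/
theorem onsStep_inner_le (hD : 0 ≤ D) (hβ : 0 < β) (g yt : Vec d)
    {s : Vec d × Matrix (Fin d) (Fin d) ℝ} (hM : s.2.PosDef) {x : Vec d} (hx : ‖x‖ ≤ D) :
    inner ℝ (expGrad β g yt s.1) (s.1 - x) - β / 2 * (inner ℝ (expGrad β g yt s.1) (s.1 - x)) ^ 2
      ≤ β / 2 * ((s.1 - x).ofLp ⬝ᵥ (s.2 *ᵥ (s.1 - x).ofLp)
          - ((onsStep D β g yt s).1 - x).ofLp ⬝ᵥ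
            ((onsStep D β g yt s).2 *ᵥ ((onsStep D β g yt s).1 - x).ofLp))
        + 1 / (2 * β) * (Real.log (onsStep D β g yt s).2.det - Real.log s.2.det) := by
  simp only [onsStep]
  set h := expGrad β g yt s.1
  have hM' : (s.2 + Matrix.vecMulVec h.ofLp h.ofLp).PosDef :=
    hM.add_posSemidef (posSemidef_vecMulVec _)
  have hlog := dotProduct_inv_mulVec_le_log_det hM h.ofLp
  set M := s.2 + Matrix.vecMulVec h.ofLp h.ofLp with hMdef
  set w := M⁻¹ *ᵥ h.ofLp with hw
  have hMw : M *ᵥ w = h.ofLp := by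
    rw [hw, Matrix.mulVec_mulVec, Matrix.mul_nonsing_inv _ hM'.det_pos.ne'.isUnit,
      Matrix.one_mulVec]
  have h1 := quadForm_ballProj_sub_le hD hM'.posSemidef (s.1 - (1 / β) • WithLp.toLp 2 w) hx
  have e1 : (s.1 - (1 / β) • WithLp.toLp 2 w - x).ofLp = (s.1 - x).ofLp + (-(1 / β)) • w := by
    rw [sub_right_comm, WithLp.ofLp_sub, WithLp.ofLp_smul, neg_smul, sub_eq_add_neg]
  have e2 : (s.1 - x).ofLp ⬝ᵥ (M *ᵥ (s.1 - x).ofLp)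
      = (s.1 - x).ofLp ⬝ᵥ (s.2 *ᵥ (s.1 - x).ofLp) + (inner ℝ h (s.1 - x)) ^ 2 := by
    rw [hMdef, Matrix.add_mulVec, dotProduct_add, Matrix.vecMulVec_mulVec, dotProduct_smul,
      vec_inner_eq_dotProduct, dotProduct_comm (s.1 - x).ofLp h.ofLp]
    simp [sq]
  rw [e1, hM'.isHermitian.quadForm_add, quadForm_smul, Matrix.mulVec_smul, dotProduct_smul,
    smul_eq_mul, hMw, e2, dotProduct_comm (s.1 - x).ofLp h.ofLp, ← vec_inner_eq_dotProduct h,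
    dotProduct_comm w] at h1
  have e3 : 1 / (2 * β) * (h.ofLp ⬝ᵥ w) = β / 2 * ((-(1 / β)) ^ 2 * (h.ofLp ⬝ᵥ w)) := by
    field_simp
  have e4 : (inner ℝ h (s.1 - x) : ℝ) = β / 2 * -(2 * (-(1 / β) * inner ℝ h (s.1 - x))) := by
    field_simp
  have h2 := mul_le_mul_of_nonneg_left h1 (half_pos hβ).le
  have h3 := mul_le_mul_of_nonneg_left hlog (by positivity : 0 ≤ 1 / (2 * β))
  rw [mul_add, mul_add, mul_add] at h2
  rw [mul_neg] at e4
  rw [mul_sub]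
  linarith

/-- The online Newton step has logarithmic regret against the quadratic models of the losses. -/
theorem ons_regret_le (hD : 0 < D) (hβ : 0 < β)
    (hs : ∀ t, s (t + 1) = onsStep D β (g t) (yt t) (s t)) (h1 : ‖(s 0).1‖ ≤ D)
    (h0 : (s 0).2 = (1 / (β ^ 2 * D ^ 2)) • (1 : Matrix (Fin d) (Fin d) ℝ))
    {x : Vec d} (hx : ‖x‖ ≤ D) (n : ℕ) :
    ∑ t ∈ Finset.range n, (inner ℝ (expGrad β (g t) (yt t) (s t).1) ((s t).1 - x)
        - β / 2 * (inner ℝ (expGrad β (g t) (yt t) (s t).1) ((s t).1 - x)) ^ 2)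
      ≤ 2 / β + d / (2 * β) * Real.log (1 + β ^ 2 * D ^ 2
        * (∑ t ∈ Finset.range n, ‖expGrad β (g t) (yt t) (s t).1‖ ^ 2) / d) := by
  have hκ : 0 < 1 / (β ^ 2 * D ^ 2) := by positivity
  have hP0 : (s 0).2.PosDef := by rw [h0]; exact Matrix.PosDef.one.smul hκ
  have hP := ons_posDef hs hP0
  have key : ∑ t ∈ Finset.range n, (inner ℝ (expGrad β (g t) (yt t) (s t).1) ((s t).1 - x)
        - β / 2 * (inner ℝ (expGrad β (g t) (yt t) (s t).1) ((s t).1 - x)) ^ 2)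
      ≤ β / 2 * (((s 0).1 - x).ofLp ⬝ᵥ ((s 0).2 *ᵥ ((s 0).1 - x).ofLp)
          - ((s n).1 - x).ofLp ⬝ᵥ ((s n).2 *ᵥ ((s n).1 - x).ofLp))
        + 1 / (2 * β) * (Real.log (s n).2.det - Real.log (s 0).2.det) := by
    induction n with
    | zero => simp
    | succ n ih =>
      rw [Finset.sum_range_succ]
      have h := onsStep_inner_le hD.le hβ (g n) (yt n) (hP n) hx
      rw [← hs] at h
      linarith
  have h2 : 0 ≤ ((s n).1 - x).ofLp ⬝ᵥ ((s n).2 *ᵥ ((s n).1 - x).ofLp) := by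
    simpa using (hP n).posSemidef.dotProduct_mulVec_nonneg ((s n).1 - x).ofLp
  have h3 : β / 2 * (((s 0).1 - x).ofLp ⬝ᵥ ((s 0).2 *ᵥ ((s 0).1 - x).ofLp)) ≤ 2 / β := by
    rw [h0, Matrix.smul_mulVec, Matrix.one_mulVec, dotProduct_smul, ← vec_inner_eq_dotProduct,
      real_inner_self_eq_norm_sq, smul_eq_mul]
    have e : (2 : ℝ) / β = β / 2 * (1 / (β ^ 2 * D ^ 2) * (4 * D ^ 2)) := by field_simp; ring
    rw [e]
    have := norm_sub_sq_le_four_mul h1 hx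
    gcongr
  have h4 : Real.log (s n).2.det - Real.log (s 0).2.det ≤ d * Real.log (1 + β ^ 2 * D ^ 2
        * (∑ t ∈ Finset.range n, ‖expGrad β (g t) (yt t) (s t).1‖ ^ 2) / d) := by
    rcases Nat.eq_zero_or_pos d with rfl | hd
    · simp
    have hd0 : (0 : ℝ) < d := by exact_mod_cast hd
    have h5 := (hP n).log_det_le
    rw [ons_trace hs n] at h5
    set S := ∑ t ∈ Finset.range n, ‖expGrad β (g t) (yt t) (s t).1‖ ^ 2
    have hS0 : 0 ≤ S := Finset.sum_nonneg fun _ _ => by positivity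
    have e1 : (s 0).2.det = (1 / (β ^ 2 * D ^ 2)) ^ d := by rw [h0]; simp
    have e2 : ((s 0).2.trace + S) / d
        = (1 + β ^ 2 * D ^ 2 * S / d) * (1 / (β ^ 2 * D ^ 2)) := by
      rw [h0, Matrix.trace_smul, Matrix.trace_one, Fintype.card_fin, smul_eq_mul]
      field_simp
    rw [e2, Real.log_mul (by positivity) hκ.ne'] at h5
    rw [e1, Real.log_pow]
    linarith
  have h5 := mul_le_mul_of_nonneg_left h4 (by positivity : 0 ≤ 1 / (2 * β))
  have e : ∀ r : ℝ, 1 / (2 * β) * (d * r) = d / (2 * β) * r := fun r => by ring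
  rw [e] at h5
  have h6 : 0 ≤ β / 2 * (((s n).1 - x).ofLp ⬝ᵥ ((s n).2 *ᵥ ((s n).1 - x).ofLp)) := by positivity
  linarith

end ONS

end

/-! ### The meta-algorithm -/

/-- The logarithm of the number of experts. -/
noncomputable def logCard (T : ℕ) : ℝ := Real.log (Fintype.card (Expert T))

theorem card_expert (T : ℕ) : Fintype.card (Expert T) = 2 * Nat.clog 2 T + 3 := by
  simp only [Fintype.card_sum, Fintype.card_unit, Fintype.card_fin]; ring

theorem one_le_logCard (T : ℕ) : 1 ≤ logCard T := by
  unfold logCard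
  rw [Real.le_log_iff_exp_le (by rw [card_expert]; positivity), card_expert]
  have := Real.exp_one_lt_d9
  push_cast
  have : (0 : ℝ) ≤ Nat.clog 2 T := by positivity
  linarith

theorem one_add_log_le_card {T : ℕ} (hT : 1 ≤ T) :
    1 + Real.log T ≤ Fintype.card (Expert T) := by
  have h1 : T ≤ 2 ^ Nat.clog 2 T := Nat.le_pow_clog one_lt_two T
  have h2 : Real.log T ≤ Nat.clog 2 T * Real.log 2 := by
    rw [← Real.log_pow]
    exact Real.log_le_log (by exact_mod_cast hT) (by exact_mod_cast h1)
  rw [card_expert]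
  push_cast
  have h3 : (0 : ℝ) ≤ Nat.clog 2 T := by positivity
  nlinarith [Real.log_two_lt_d9]

theorem one_le_logLog {T : ℕ} (hT : 1 ≤ T) : 1 ≤ logLog T := by
  have h1 := Real.log_nonneg (x := T) (by exact_mod_cast hT)
  have h2 := Real.log_nonneg (x := 1 + Real.log T) (by linarith)
  rw [logLog]; linarith

theorem logCard_le {T : ℕ} (hT : 1 ≤ T) : logCard T ≤ 3 * logLog T := by
  have hT1 : (1 : ℝ) ≤ T := by exact_mod_cast hT
  have hl : 0 ≤ Real.log T := Real.log_nonneg hT1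
  have h1 : (Nat.clog 2 T : ℝ) ≤ Real.log T / Real.log 2 + 1 := by
    rcases Nat.eq_zero_or_pos (Nat.clog 2 T) with h | h
    · rw [h]; have := Real.log_nonneg one_le_two; push_cast; positivity
    · have hT2 : 1 < T := by
        by_contra! hle
        rw [Nat.clog_of_right_le_one hle] at h
        exact lt_irrefl _ h
      have h2 := Nat.pow_pred_clog_lt_self one_lt_two hT2
      have h3 : ((Nat.clog 2 T).pred : ℝ) * Real.log 2 ≤ Real.log T := by
        rw [← Real.log_pow]
        exact Real.log_le_log (by positivity) (by exact_mod_cast h2.le)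
      rw [Nat.pred_eq_sub_one, Nat.cast_sub h, Nat.cast_one] at h3
      rw [← sub_le_iff_le_add, le_div_iff₀ (Real.log_pos one_lt_two)]
      exact h3
  have h2 : Real.log T / Real.log 2 ≤ 2 * Real.log T := by
    rw [div_le_iff₀ (Real.log_pos one_lt_two)]
    nlinarith [Real.log_two_gt_d9]
  have h3 : (Fintype.card (Expert T) : ℝ) ≤ Real.exp 2 * (1 + Real.log T) := by
    rw [card_expert]
    push_cast
    have h4 : (5 : ℝ) ≤ Real.exp 2 := by
      have e : Real.exp 2 = Real.exp 1 ^ 2 := by rw [← Real.exp_nat_mul]; norm_num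
      rw [e]; nlinarith [Real.exp_one_gt_d9]
    nlinarith
  unfold logCard logLog
  have hcard : (0 : ℝ) < Fintype.card (Expert T) := by rw [card_expert]; positivity
  refine (Real.log_le_log hcard h3).trans ?_
  rw [Real.log_mul (Real.exp_pos _).ne' (by positivity), Real.log_exp]
  have := Real.log_nonneg (x := 1 + Real.log T) (by linarith)
  linarith

namespace UniversalState

theorem rate_eq (T : ℕ) (S : ℝ) : rate T S = min (1 / 2) √(logCard T / (1 + S)) := rfl

theorem rate_pos (T : ℕ) {S : ℝ} (hS : 0 ≤ S) : 0 < rate T S := by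
  have := one_le_logCard T
  rw [rate_eq]
  exact lt_min (by norm_num) (Real.sqrt_pos.2 (div_pos (by linarith) (by linarith)))

theorem rate_le_half (T : ℕ) (S : ℝ) : rate T S ≤ 1 / 2 := min_le_left _ _

theorem rate_zero (T : ℕ) : rate T 0 = 1 / 2 := by
  rw [rate_eq, min_eq_left]
  rw [add_zero, div_one]
  have h := Real.one_le_sqrt.2 (one_le_logCard T)
  linarith

theorem rate_anti (T : ℕ) {S c : ℝ} (hS : 0 ≤ S) (hc : 0 ≤ c) : rate T (S + c) ≤ rate T S := by
  have := one_le_logCard T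
  rw [rate_eq, rate_eq]
  refine min_le_min le_rfl (Real.sqrt_le_sqrt ?_)
  gcongr
  linarith

theorem inv_rate_le (T : ℕ) (S : ℝ) :
    (rate T S)⁻¹ ≤ 2 + √((1 + S) / logCard T) := by
  rw [rate_eq]
  rcases min_cases (1 / 2 : ℝ) √(logCard T / (1 + S)) with ⟨h, _⟩ | ⟨h, _⟩ <;> rw [h]
  · have := Real.sqrt_nonneg ((1 + S) / logCard T); norm_num
  · rw [← Real.sqrt_inv, inv_div]; linarith

/-- The relative decrease of the learning rate telescopes. -/
theorem rate_div_rate_sub_one_le (T : ℕ) {S c : ℝ} (hS : 0 ≤ S) (hc : 0 ≤ c) (hc1 : c ≤ 1 / 4) :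
    rate T S / rate T (S + c) - 1 ≤ Real.log (1 + (S + c)) - Real.log (1 + S) := by
  have hΛ := one_le_logCard T
  have hS1 : 0 < 1 + S := by linarith
  set x := c / (1 + S) with hx
  have hx0 : 0 ≤ x := by positivity
  have hx1 : x ≤ 1 / 4 := by rw [hx, div_le_iff₀ hS1]; linarith
  have e : (1 + (S + c)) / (1 + S) = 1 + x := by rw [hx]; field_simp; ring
  rw [← Real.log_div (by linarith) hS1.ne', e]
  have h1 : rate T S ≤ √(1 + x) * rate T (S + c) := by
    rw [rate_eq, rate_eq, mul_min_of_nonneg _ _ (Real.sqrt_nonneg _)]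
    refine min_le_min ?_ ?_
    · have := Real.one_le_sqrt.2 (show 1 ≤ 1 + x by linarith)
      linarith
    · rw [← Real.sqrt_mul (by linarith)]
      refine Real.sqrt_le_sqrt (le_of_eq ?_)
      rw [← e]
      have : 1 + (S + c) ≠ 0 := by linarith
      field_simp
  have h2 : rate T S / rate T (S + c) ≤ √(1 + x) := by
    rwa [div_le_iff₀ (rate_pos T (by linarith))]
  have h3 : √(1 + x) ≤ 1 + x / 2 := by
    rw [Real.sqrt_le_left (by linarith)]; nlinarith
  have h4 := sub_sq_le_log_one_add (x := x) (by linarith)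
  nlinarith

/-- The second-order terms telescope. -/
theorem rate_mul_sq_le (T : ℕ) {S r : ℝ} (hS : 0 ≤ S) (hr : |r| ≤ 1 / 2) :
    rate T S * r ^ 2 ≤ 3 * √(logCard T) * (√(1 + (S + r ^ 2)) - √(1 + S)) := by
  have hr2 : r ^ 2 ≤ 1 / 4 := by
    rw [← sq_abs]; nlinarith [abs_nonneg r]
  have hS1 : 0 < 1 + S := by linarith
  set q := √(1 + S) with hq
  set q' := √(1 + (S + r ^ 2)) with hq'
  have hqpos : 0 < q := Real.sqrt_pos.2 hS1
  have hqq : q ≤ q' := Real.sqrt_le_sqrt (by linarith [sq_nonneg r])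
  have hqs : q ^ 2 = 1 + S := Real.sq_sqrt hS1.le
  have hqs' : q' ^ 2 = 1 + (S + r ^ 2) := Real.sq_sqrt (by positivity)
  have hq2 : q' ≤ 2 * q := by nlinarith
  have h1 : rate T S ≤ √(logCard T) / q := by
    rw [hq, ← Real.sqrt_div (by linarith [one_le_logCard T])]
    exact min_le_right _ _
  have h2 : r ^ 2 ≤ 3 * q * (q' - q) := by nlinarith
  calc rate T S * r ^ 2 ≤ √(logCard T) / q * (3 * q * (q' - q)) := by gcongr
    _ = 3 * √(logCard T) * (q' - q) := by field_simp

end UniversalState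

open UniversalState

section AdaptProd

variable {T n : ℕ} {w V r : ℕ → Expert T → ℝ}

theorem meta_dev_eq (hV0 : ∀ i, V 0 i = 0) (hV : ∀ t i, V (t + 1) i = V t i + r t i ^ 2)
    (n : ℕ) (i : Expert T) : V n i = ∑ t ∈ Finset.range n, r t i ^ 2 := by
  induction n with
  | zero => simp [hV0]
  | succ n ih => rw [hV, Finset.sum_range_succ, ih]

theorem meta_dev_nonneg (hV0 : ∀ i, V 0 i = 0) (hV : ∀ t i, V (t + 1) i = V t i + r t i ^ 2)
    (n : ℕ) (i : Expert T) : 0 ≤ V n i := by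
  rw [meta_dev_eq hV0 hV]; exact Finset.sum_nonneg fun _ _ => sq_nonneg _

theorem neg_quarter_le_rate_mul (T : ℕ) {S r : ℝ} (hS : 0 ≤ S) (hr : |r| ≤ 1 / 2) :
    -(1 / 4) ≤ rate T S * r := by
  have h1 := rate_pos T hS
  have h2 := rate_le_half T S
  have h3 := (abs_le.1 hr).1
  nlinarith

theorem meta_weight_pos (hV0 : ∀ i, V 0 i = 0) (hV : ∀ t i, V (t + 1) i = V t i + r t i ^ 2)
    (hw0 : ∀ i, w 0 i = 1 / Fintype.card (Expert T))
    (hw : ∀ t i, w (t + 1) i = (w t i * (1 + rate T (V t i) * r t i)) ^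
      (rate T (V (t + 1) i) / rate T (V t i)))
    (hr : ∀ t < n, ∀ i, |r t i| ≤ 1 / 2) (i : Expert T) : 0 < w n i := by
  induction n with
  | zero => rw [hw0, card_expert]; positivity
  | succ n ih =>
    rw [hw]
    refine Real.rpow_pos_of_pos (mul_pos (ih fun t ht => hr t (by omega)) ?_) _
    linarith [neg_quarter_le_rate_mul T (meta_dev_nonneg hV0 hV n i) (hr n (by omega) i)]

/-- The sum of the weights grows only through the changes of the learning rates: the first-order
terms cancel because the learner's loss is the average of the losses of the experts. -/
theorem meta_sum_weight_le (hV0 : ∀ i, V 0 i = 0) (hV : ∀ t i, V (t + 1) i = V t i + r t i ^ 2)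
    (hw0 : ∀ i, w 0 i = 1 / Fintype.card (Expert T))
    (hw : ∀ t i, w (t + 1) i = (w t i * (1 + rate T (V t i) * r t i)) ^
      (rate T (V (t + 1) i) / rate T (V t i)))
    (hr : ∀ t < n, ∀ i, |r t i| ≤ 1 / 2)
    (hsum : ∀ t < n, ∑ i, rate T (V t i) * w t i * r t i = 0) :
    ∑ i, w n i ≤ 1 + ∑ i, Real.log (1 + V n i) := by
  induction n with
  | zero =>
    have : (Fintype.card (Expert T) : ℝ) ≠ 0 := by rw [card_expert]; positivity
    simp only [hw0, hV0, Finset.sum_const, Finset.card_univ, nsmul_eq_mul, add_zero, Real.log_one,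
      mul_zero]
    rw [mul_one_div_cancel this]
  | succ n ih =>
    have ih := ih (fun t ht => hr t (by omega)) (fun t ht => hsum t (by omega))
    have hstep : ∀ i, w (n + 1) i ≤ w n i + rate T (V n i) * w n i * r n i
        + (Real.log (1 + V (n + 1) i) - Real.log (1 + V n i)) := by
      intro i
      have hVn := meta_dev_nonneg hV0 hV n i
      have hri := hr n (by omega) i
      have hr2 : r n i ^ 2 ≤ 1 / 4 := by
        rw [← sq_abs]; nlinarith [abs_nonneg (r n i)]
      have h1 := rate_pos T hVn
      have h2 : 0 < rate T (V n i + r n i ^ 2) := rate_pos T (by positivity)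
      have h3 := rpow_le_add_inv_sub_one (x := w n i * (1 + rate T (V n i) * r n i))
        (e := rate T (V n i + r n i ^ 2) / rate T (V n i))
        (mul_nonneg (meta_weight_pos (n := n) hV0 hV hw0 hw (fun t ht => hr t (by omega)) i).le
          (by linarith [neg_quarter_le_rate_mul T hVn hri])) (by positivity)
        ((div_le_one h1).2 (rate_anti T hVn (sq_nonneg _)))
      have h4 := rate_div_rate_sub_one_le T hVn (sq_nonneg (r n i)) hr2
      rw [hw, hV]
      rw [inv_div] at h3
      linarith
    refine (Finset.sum_le_sum fun i _ => hstep i).trans ?_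
    rw [Finset.sum_add_distrib, Finset.sum_add_distrib, Finset.sum_sub_distrib,
      hsum n (by omega)]
    linarith

/-- The exponent in the update of the weights makes `log w / η` telescope. -/
theorem meta_log_weight_ge (hV0 : ∀ i, V 0 i = 0) (hV : ∀ t i, V (t + 1) i = V t i + r t i ^ 2)
    (hw0 : ∀ i, w 0 i = 1 / Fintype.card (Expert T))
    (hw : ∀ t i, w (t + 1) i = (w t i * (1 + rate T (V t i) * r t i)) ^
      (rate T (V (t + 1) i) / rate T (V t i)))
    (hr : ∀ t < n, ∀ i, |r t i| ≤ 1 / 2) (i : Expert T) :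
    ∑ t ∈ Finset.range n, (r t i - rate T (V t i) * r t i ^ 2) - 2 * logCard T
      ≤ Real.log (w n i) / rate T (V n i) := by
  induction n with
  | zero =>
    rw [hV0, rate_zero, hw0, one_div, Real.log_inv]
    simp only [Finset.range_zero, Finset.sum_empty, logCard]
    linarith
  | succ n ih =>
    have ih := ih (fun t ht => hr t (by omega))
    have hVn := meta_dev_nonneg hV0 hV n i
    have hlow := neg_quarter_le_rate_mul T hVn (hr n (by omega) i)
    have hη := rate_pos T hVn
    have hη' := rate_pos T (meta_dev_nonneg hV0 hV (n + 1) i)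
    have hwpos := meta_weight_pos (n := n) hV0 hV hw0 hw (fun t ht => hr t (by omega)) i
    have hpos : 0 < 1 + rate T (V n i) * r n i := by linarith
    have e : Real.log (w (n + 1) i) / rate T (V (n + 1) i)
        = Real.log (w n i) / rate T (V n i)
          + Real.log (1 + rate T (V n i) * r n i) / rate T (V n i) := by
      rw [hw, Real.log_rpow (mul_pos hwpos hpos), Real.log_mul hwpos.ne' hpos.ne']
      field_simp
    have h1 : r n i - rate T (V n i) * r n i ^ 2
        ≤ Real.log (1 + rate T (V n i) * r n i) / rate T (V n i) := by
      rw [le_div_iff₀ hη]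
      have := sub_sq_le_log_one_add hlow
      nlinarith
    rw [e, Finset.sum_range_succ]
    linarith

/-- Second-order regret bound of the meta-algorithm. -/
theorem meta_regret_le (hT : 1 ≤ T) (hn : n ≤ T) (hV0 : ∀ i, V 0 i = 0)
    (hV : ∀ t i, V (t + 1) i = V t i + r t i ^ 2)
    (hw0 : ∀ i, w 0 i = 1 / Fintype.card (Expert T))
    (hw : ∀ t i, w (t + 1) i = (w t i * (1 + rate T (V t i) * r t i)) ^
      (rate T (V (t + 1) i) / rate T (V t i)))
    (hr : ∀ t < n, ∀ i, |r t i| ≤ 1 / 2)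
    (hsum : ∀ t < n, ∑ i, rate T (V t i) * w t i * r t i = 0) (i : Expert T) :
    ∑ t ∈ Finset.range n, r t i
      ≤ 8 * logCard T + 6 * √(logCard T * (1 + ∑ t ∈ Finset.range n, r t i ^ 2)) := by
  have hΛ := one_le_logCard T
  have hVn := meta_dev_nonneg hV0 hV n
  have hT1 : (1 : ℝ) ≤ T := by exact_mod_cast hT
  rw [← meta_dev_eq hV0 hV n i]
  set K : ℝ := ((Fintype.card (Expert T) : ℕ) : ℝ) with hK
  have hK3 : 3 ≤ K := by
    rw [hK, card_expert]; push_cast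
    have : (0 : ℝ) ≤ Nat.clog 2 T := by positivity
    linarith
  have hlogw : Real.log (w n i) ≤ 3 * logCard T := by
    have hpos := meta_weight_pos hV0 hV hw0 hw hr
    have h1 : w n i ≤ ∑ j, w n j :=
      Finset.single_le_sum (fun j _ => (hpos j).le) (Finset.mem_univ i)
    have h2 : ∀ j, Real.log (1 + V n j) ≤ K := fun j => by
      have h3 : V n j ≤ T := by
        rw [meta_dev_eq hV0 hV]
        refine (Finset.sum_le_card_nsmul _ _ 1 fun t ht => ?_).trans ?_
        · have := hr t (Finset.mem_range.1 ht) j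
          rw [← sq_abs]; nlinarith [abs_nonneg (r t j)]
        · simpa using hn
      have h4 : Real.log (1 + V n j) ≤ Real.log (2 * T) :=
        Real.log_le_log (by linarith [hVn j]) (by linarith)
      rw [Real.log_mul two_ne_zero (by linarith)] at h4
      linarith [one_add_log_le_card hT, Real.log_two_lt_d9]
    have h3 : w n i ≤ K ^ 3 := by
      have h4 := meta_sum_weight_le hV0 hV hw0 hw hr hsum
      have h5 : ∑ j, Real.log (1 + V n j) ≤ K * K := by
        refine (Finset.sum_le_card_nsmul _ _ K fun j _ => h2 j).trans (le_of_eq ?_)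
        rw [nsmul_eq_mul, Finset.card_univ]
      nlinarith
    have h4 := Real.log_le_log (hpos i) h3
    rw [Real.log_pow] at h4
    exact_mod_cast h4
  have hB := meta_log_weight_ge hV0 hV hw0 hw hr i
  have hC : ∑ t ∈ Finset.range n, rate T (V t i) * r t i ^ 2
      ≤ 3 * √(logCard T) * √(1 + V n i) := by
    have h1 : ∀ m ≤ n, ∑ t ∈ Finset.range m, rate T (V t i) * r t i ^ 2
        ≤ 3 * √(logCard T) * √(1 + V m i) := by
      intro m hm
      induction m with
      | zero => simp only [Finset.range_zero, Finset.sum_empty]; positivity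
      | succ m ih =>
        rw [Finset.sum_range_succ, hV]
        have := rate_mul_sq_le T (meta_dev_nonneg hV0 hV m i) (hr m (by omega) i)
        linarith [ih (by omega)]
    exact h1 n le_rfl
  have hD : Real.log (w n i) / rate T (V n i)
      ≤ 6 * logCard T + 3 * (√(logCard T) * √(1 + V n i)) := by
    have hη := rate_pos T (hVn i)
    have h1 : Real.log (w n i) / rate T (V n i) ≤ 3 * logCard T * (rate T (V n i))⁻¹ := by
      rw [div_eq_mul_inv]
      gcongr
    have h2 := mul_le_mul_of_nonneg_left (inv_rate_le T (V n i))
      (by linarith : 0 ≤ 3 * logCard T)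
    have e : logCard T * √((1 + V n i) / logCard T) = √(logCard T) * √(1 + V n i) := by
      rw [Real.sqrt_div (by linarith [hVn i])]
      have h3 := Real.mul_self_sqrt (show 0 ≤ logCard T by linarith)
      have h4 : 0 < √(logCard T) := Real.sqrt_pos.2 (by linarith)
      field_simp
      rw [sq, h3, mul_comm]
    linarith
  rw [Finset.sum_sub_distrib] at hB
  rw [Real.sqrt_mul (by linarith)]
  linarith

end AdaptProd

namespace UniversalState

variable {d T : ℕ}

/-- The properties of a state that every round preserves. -/
structure Valid (s : UniversalState d T) (D : ℝ) : Prop where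
  weight_pos : ∀ i, 0 < s.weight i
  dev_nonneg : ∀ i, 0 ≤ s.dev i
  norm_point_le : ∀ i, ‖s.point i‖ ≤ D

namespace Valid

variable {s : UniversalState d T} {D G : ℝ}

theorem sum_pos (h : s.Valid D) : 0 < ∑ j, rate T (s.dev j) * s.weight j :=
  Finset.sum_pos (fun i _ => mul_pos (rate_pos T (h.dev_nonneg i)) (h.weight_pos i))
    ⟨Sum.inl (), Finset.mem_univ _⟩

theorem prob_nonneg (h : s.Valid D) (i : Expert T) : 0 ≤ s.prob i :=
  div_nonneg (mul_pos (rate_pos T (h.dev_nonneg i)) (h.weight_pos i)).le h.sum_pos.le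

theorem sum_prob (h : s.Valid D) : ∑ i, s.prob i = 1 := by
  unfold prob
  rw [← Finset.sum_div, div_self h.sum_pos.ne']

theorem norm_aggregate_le (h : s.Valid D) : ‖s.aggregate‖ ≤ D := by
  rw [← mem_closedBall_zero_iff]
  exact (convex_closedBall (0 : Vec d) D).sum_mem (fun i _ => h.prob_nonneg i) h.sum_prob
    fun i _ => mem_closedBall_zero_iff.2 (h.norm_point_le i)

theorem sum_prob_inner (h : s.Valid D) (g : Vec d) :
    ∑ i, s.prob i * inner ℝ g (s.point i - s.aggregate) = 0 := by
  have e : ∑ i, s.prob i • (s.point i - s.aggregate) = 0 := by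
    simp only [smul_sub, Finset.sum_sub_distrib, ← Finset.sum_smul, h.sum_prob, one_smul]
    exact sub_self _
  simp only [← inner_smul_right]
  rw [← inner_sum, e, inner_zero_right]

theorem metaGap_eq (h : s.Valid D) (g : Vec d) (i : Expert T) :
    s.metaGap D G g i = inner ℝ g (s.aggregate - s.point i) / (4 * G * D) := by
  have e : ∑ j, s.prob j * s.metaLoss D G g j = 1 / 2 := by
    unfold metaLoss
    simp only [mul_add, Finset.sum_add_distrib, ← Finset.sum_mul, h.sum_prob, mul_div_assoc',
      ← Finset.sum_div, h.sum_prob_inner]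
    norm_num
  unfold metaGap
  rw [e, metaLoss, ← neg_sub (s.point i), inner_neg_right]
  ring

theorem sum_rate_mul_metaGap (h : s.Valid D) (g : Vec d) :
    ∑ i, rate T (s.dev i) * s.weight i * s.metaGap D G g i = 0 := by
  have e : ∀ i, rate T (s.dev i) * s.weight i * s.metaGap D G g i
      = -(s.prob i * inner ℝ g (s.point i - s.aggregate))
        * ((∑ j, rate T (s.dev j) * s.weight j) / (4 * G * D)) := fun i => by
    rw [h.metaGap_eq, prob, ← neg_sub (s.point i), inner_neg_right]
    have := h.sum_pos.ne'
    field_simp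
  simp only [e]
  rw [← Finset.sum_mul, Finset.sum_neg_distrib, h.sum_prob_inner]
  simp

theorem abs_inner_le (h : s.Valid D) {g : Vec d} (hg : ‖g‖ ≤ G) (i : Expert T) :
    |(inner ℝ g (s.aggregate - s.point i) : ℝ)| ≤ 2 * G * D := by
  have h1 : ‖s.aggregate - s.point i‖ ≤ D + D :=
    (norm_sub_le _ _).trans (add_le_add h.norm_aggregate_le (h.norm_point_le i))
  calc _ ≤ ‖g‖ * ‖s.aggregate - s.point i‖ := abs_real_inner_le_norm _ _
    _ ≤ G * (D + D) := mul_le_mul hg h1 (norm_nonneg _) ((norm_nonneg _).trans hg)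
    _ = 2 * G * D := by ring

theorem abs_metaGap_le (hD : 0 < D) (hG : 0 < G) (h : s.Valid D) {g : Vec d} (hg : ‖g‖ ≤ G)
    (i : Expert T) : |s.metaGap D G g i| ≤ 1 / 2 := by
  have h1 := h.abs_inner_le hg i
  rw [h.metaGap_eq, abs_div, abs_of_pos (show 0 < 4 * G * D by positivity),
    div_le_iff₀ (by positivity)]
  linarith

end Valid

theorem valid_initial (I : UniversalInput d) (hf : ∀ i, ‖I.first i‖ ≤ I.D) :
    (initial I).Valid I.D where
  weight_pos i := by simp only [initial]; rw [card_expert]; positivity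
  dev_nonneg i := le_rfl
  norm_point_le i := by
    rcases i with i | i | i <;> exact hf _

theorem Valid.next {I : UniversalInput d} (hD : 0 < I.D) (hG : 0 < I.G)
    {s : UniversalState d I.T} (h : s.Valid I.D) {x v : Vec d} (hv : ‖v‖ ≤ I.G) :
    (s.next I x v).Valid I.D where
  weight_pos i := by
    have h1 := h.abs_metaGap_le hD hG ((norm_surrGrad_le s.aggregate x v).trans hv) i
    have h2 := neg_quarter_le_rate_mul I.T (h.dev_nonneg i) h1
    exact Real.rpow_pos_of_pos (mul_pos (h.weight_pos i) (by linarith)) _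
  dev_nonneg i := add_nonneg (h.dev_nonneg i) (sq_nonneg _)
  norm_point_le i := by
    rcases i with i | i | i
    · exact norm_ballClip_le hD.le _
    · exact norm_ballProj_le hD.le _ _
    · exact norm_ballClip_le hD.le _

end UniversalState

/-- A run of the universal algorithm over its horizon: `s` are the states, `x` the submitted
decisions, `v` the gradients of the losses at them and `g` the surrogate gradients.  Nothing is
required of the losses or of the way in which the decisions come about, except for the bounds on
`x` and `v`. -/
structure IsRun {d : ℕ} (I : UniversalInput d) (s : ℕ → UniversalState d I.T)
    (x v g : ℕ → Vec d) : Prop where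
  D_pos : 0 < I.D
  G_pos : 0 < I.G
  one_le_T : 1 ≤ I.T
  norm_first_le : ∀ i, ‖I.first i‖ ≤ I.D
  zero : s 0 = initial I
  succ : ∀ t, s (t + 1) = (s t).next I (x t) (v t)
  surr : ∀ t, g t = surrGrad (s t).aggregate (x t) (v t)
  norm_x_le : ∀ t < I.T, ‖x t‖ ≤ I.D
  norm_v_le : ∀ t < I.T, ‖v t‖ ≤ I.G

/-- Absorption of the root in a second-order regret bound by a multiple of the sum of squares. -/
theorem sub_mul_le_of_le_sqrt {p V M Λ ρ : ℝ} (hM : 0 < M) (hΛ : 0 ≤ Λ) (hρ : 0 < ρ) (hV : 0 ≤ V)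
    (h : p ≤ M * (8 * Λ + 6 * √(Λ * (1 + V / M ^ 2)))) :
    p - ρ * V ≤ 8 * M * Λ + ρ * M ^ 2 + 9 * Λ / ρ := by
  have h1 : 6 * M * √(Λ * (1 + V / M ^ 2)) ≤ ρ * (M ^ 2 + V) + 9 * Λ / ρ := by
    refine le_of_sq_le_sq ?_ (by positivity)
    rw [mul_pow, Real.sq_sqrt (by positivity)]
    have e : (6 * M) ^ 2 * (Λ * (1 + V / M ^ 2))
        = 4 * (ρ * (M ^ 2 + V)) * (9 * Λ / ρ) := by field_simp; ring
    rw [e]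
    nlinarith [sq_nonneg (ρ * (M ^ 2 + V) - 9 * Λ / ρ)]
  linarith

namespace IsRun

variable {d : ℕ} {I : UniversalInput d} {s : ℕ → UniversalState d I.T} {x v g : ℕ → Vec d}

theorem valid (h : IsRun I s x v g) {n : ℕ} (hn : n ≤ I.T) : (s n).Valid I.D := by
  induction n with
  | zero => rw [h.zero]; exact valid_initial I h.norm_first_le
  | succ n ih =>
    rw [h.succ]; exact (ih (by omega)).next h.D_pos h.G_pos (h.norm_v_le n (by omega))

theorem norm_g_le_norm_v (h : IsRun I s x v g) (t : ℕ) : ‖g t‖ ≤ ‖v t‖ := by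
  rw [h.surr]; exact norm_surrGrad_le _ _ _

theorem norm_g_le (h : IsRun I s x v g) {t : ℕ} (ht : t < I.T) : ‖g t‖ ≤ I.G :=
  (h.norm_g_le_norm_v t).trans (h.norm_v_le t ht)

/-- Second-order bound for the linearized regret of the aggregated points with respect to the
points of an expert. -/
theorem meta_le (h : IsRun I s x v g) (i : Expert I.T) :
    ∑ t ∈ Finset.range I.T, inner ℝ (g t) ((s t).aggregate - (s t).point i)
      ≤ 4 * I.G * I.D * (8 * logCard I.T + 6 * √(logCard I.T * (1 + (∑ t ∈ Finset.range I.T,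
        (inner ℝ (g t) ((s t).aggregate - (s t).point i)) ^ 2) / (4 * I.G * I.D) ^ 2))) := by
  have hD := h.D_pos
  have hG := h.G_pos
  have hm := meta_regret_le (w := fun t => (s t).weight) (V := fun t => (s t).dev)
    (r := fun t => (s t).metaGap I.D I.G (g t)) h.one_le_T le_rfl
    (fun i => by rw [h.zero]; rfl) (fun t i => by rw [h.surr, h.succ]; rfl)
    (fun i => by rw [h.zero]; rfl) (fun t i => by rw [h.surr, h.succ]; rfl)
    (fun t ht i => (h.valid ht.le).abs_metaGap_le hD hG (h.norm_g_le ht) i)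
    (fun t ht => (h.valid ht.le).sum_rate_mul_metaGap _) i
  have e : ∀ t ∈ Finset.range I.T, (s t).metaGap I.D I.G (g t) i
      = inner ℝ (g t) ((s t).aggregate - (s t).point i) / (4 * I.G * I.D) := fun t ht =>
    (h.valid (Finset.mem_range.1 ht).le).metaGap_eq _ i
  have e2 : ∀ t ∈ Finset.range I.T, (s t).metaGap I.D I.G (g t) i ^ 2
      = (inner ℝ (g t) ((s t).aggregate - (s t).point i)) ^ 2 / (4 * I.G * I.D) ^ 2 :=
    fun t ht => by rw [e t ht, div_pow]
  rw [Finset.sum_congr rfl e, Finset.sum_congr rfl e2, ← Finset.sum_div, ← Finset.sum_div,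
    div_le_iff₀ (by positivity)] at hm
  linarith

/-- The regret with respect to an expert is of constant order when the squares of the gaps are
subtracted from it. -/
theorem meta_sub_sq_le (h : IsRun I s x v g) (i : Expert I.T) {ρ : ℝ} (hρ : 0 < ρ) :
    ∑ t ∈ Finset.range I.T, (inner ℝ (g t) ((s t).aggregate - (s t).point i)
        - ρ * (inner ℝ (g t) ((s t).aggregate - (s t).point i)) ^ 2)
      ≤ 8 * (4 * I.G * I.D) * logCard I.T + ρ * (4 * I.G * I.D) ^ 2 + 9 * logCard I.T / ρ := by
  have hD := h.D_pos
  have hG := h.G_pos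
  rw [Finset.sum_sub_distrib, ← Finset.mul_sum]
  exact sub_mul_le_of_le_sqrt (by positivity) (by linarith [one_le_logCard I.T]) hρ
    (Finset.sum_nonneg fun _ _ => sq_nonneg _) (h.meta_le i)

end IsRun

/-! ### Linearized regret of the universal algorithm -/

namespace IsRun

variable {d : ℕ} {I : UniversalInput d} {s : ℕ → UniversalState d I.T} {x v g : ℕ → Vec d}

/-- Linearized regret through the convex expert. -/
theorem convex_le (h : IsRun I s x v g) (ha : 0 < I.a) (hδ : 0 < I.δ) {z : Vec d}
    (hz : ‖z‖ ≤ I.D) :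
    ∑ t ∈ Finset.range I.T, inner ℝ (g t) ((s t).aggregate - z)
      ≤ 4 * I.G * I.D * (8 * logCard I.T + 6 * √(logCard I.T *
          (1 + (∑ t ∈ Finset.range I.T, ‖g t‖ ^ 2) / (4 * I.G ^ 2))))
        + (2 * I.D ^ 2 / I.a + I.a) * √(I.δ + ∑ t ∈ Finset.range I.T, ‖g t‖ ^ 2) := by
  have hD := h.D_pos
  have hG := h.G_pos
  have hΛ := one_le_logCard I.T
  have h1 := h.meta_le (Sum.inl ())
  have h2 := sogd_regret_le (g := g) (s := fun t => (s t).cvx) hD.le ha hδ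
    (fun t => by rw [h.succ, h.surr]; rfl) (by rw [h.zero]; rfl)
    (by rw [h.zero]; exact h.norm_first_le _) hz I.T
  have h3 : (∑ t ∈ Finset.range I.T,
      (inner ℝ (g t) ((s t).aggregate - (s t).point (Sum.inl ()))) ^ 2) / (4 * I.G * I.D) ^ 2
      ≤ (∑ t ∈ Finset.range I.T, ‖g t‖ ^ 2) / (4 * I.G ^ 2) := by
    have h4 : ∑ t ∈ Finset.range I.T,
        (inner ℝ (g t) ((s t).aggregate - (s t).point (Sum.inl ()))) ^ 2
        ≤ 4 * I.D ^ 2 * ∑ t ∈ Finset.range I.T, ‖g t‖ ^ 2 := by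
      rw [Finset.mul_sum]
      refine Finset.sum_le_sum fun t ht => ?_
      have hval := h.valid (Finset.mem_range.1 ht).le
      have h5 := norm_sub_sq_le_four_mul hval.norm_aggregate_le (hval.norm_point_le (Sum.inl ()))
      have h6 := pow_le_pow_left₀ (abs_nonneg _) (abs_real_inner_le_norm (g t)
        ((s t).aggregate - (s t).point (Sum.inl ()))) 2
      rw [sq_abs, mul_pow] at h6
      nlinarith [sq_nonneg ‖g t‖]
    rw [div_le_div_iff₀ (by positivity) (by positivity)]
    have := mul_le_mul_of_nonneg_right h4 (by positivity : 0 ≤ 4 * I.G ^ 2)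
    linarith
  have h4 : √(logCard I.T * (1 + (∑ t ∈ Finset.range I.T,
        (inner ℝ (g t) ((s t).aggregate - (s t).point (Sum.inl ()))) ^ 2) / (4 * I.G * I.D) ^ 2))
      ≤ √(logCard I.T * (1 + (∑ t ∈ Finset.range I.T, ‖g t‖ ^ 2) / (4 * I.G ^ 2))) := by
    gcongr
  have e : ∀ t, inner ℝ (g t) ((s t).aggregate - z)
      = inner ℝ (g t) ((s t).aggregate - (s t).point (Sum.inl ()))
        + inner ℝ (g t) ((s t).cvx.1 - z) := fun t => by
    rw [← inner_add_right]; congr 1; simp [point]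
  simp only [e, Finset.sum_add_distrib]
  have h5 := mul_le_mul_of_nonneg_left h4 (by positivity : 0 ≤ 4 * I.G * I.D * 6)
  linarith

/-- The trade-off behind the exp-concave case.  With `p` the gap between the learner and an expert
and `q` the gap between the expert and the comparator, the gradient of the loss of the expert is
`1 - β p` times the surrogate gradient.  The quadratic term `2 β (p + q)²` pays for the one lost in
the online Newton step, and a multiple of `p²` is left over. -/
theorem exp_tradeoff {β p q : ℝ} (hβ : 0 < β) (hp : |β * p| ≤ 1 / 16) :
    (p + q) - 2 * β * (p + q) ^ 2
      ≤ (p - β / 4 * p ^ 2) + ((1 - β * p) * q - β / 2 * ((1 - β * p) * q) ^ 2) := by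
  have h1 : (1 - β * p) ^ 2 ≤ 289 / 256 := by
    have := abs_le.1 hp
    nlinarith
  have h2 : (1 - β * p) ^ 2 * q ^ 2 ≤ 289 / 256 * q ^ 2 :=
    mul_le_mul_of_nonneg_right h1 (sq_nonneg q)
  have h3 : 0 ≤ 7 / 4 * p ^ 2 + 3 * (p * q) + (2 - 289 / 512) * q ^ 2 := by
    nlinarith [sq_nonneg (7 * p + 6 * q)]
  have h4 : 0 ≤ β * (7 / 4 * p ^ 2 + 3 * (p * q) + 2 * q ^ 2 - (1 - β * p) ^ 2 * q ^ 2 / 2) :=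
    mul_nonneg hβ.le (by linarith)
  nlinarith

/-- Linearized regret through the exp-concave expert with modulus `2 β`.  The bound on `β` makes the
second entry of the minimum in `expParam` the smaller one, so that the parameter of the expert is
`β`. -/
theorem exp_le (h : IsRun I s x v g) (k : ModIdx I.T) {β : ℝ}
    (hβ : modulus I.T k = 2 * β) (hβ0 : 0 < β) (hβ1 : β * (32 * I.G * I.D) ≤ 1) {z : Vec d}
    (hz : ‖z‖ ≤ I.D) :
    ∑ t ∈ Finset.range I.T, (inner ℝ (g t) ((s t).aggregate - z)
        - 2 * β * (inner ℝ (g t) ((s t).aggregate - z)) ^ 2)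
      ≤ 8 * (4 * I.G * I.D) * logCard I.T + β / 4 * (4 * I.G * I.D) ^ 2
        + 36 * logCard I.T / β + 2 / β + d / (2 * β) * Real.log (1 + β ^ 2 * (4 * I.D ^ 2
          * ∑ t ∈ Finset.range I.T, ‖g t‖ ^ 2) / d) := by
  have hD := h.D_pos
  have hG := h.G_pos
  have hparam : expParam I.D I.G (modulus I.T k) = β := by
    rw [expParam, hβ, min_eq_right]
    · ring
    · rw [le_div_iff₀ (by positivity)]; nlinarith
  have h1 := h.meta_sub_sq_le (Sum.inr (Sum.inl k)) (ρ := β / 4) (by positivity)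
  have h2 := ons_regret_le (g := g) (yt := fun t => (s t).aggregate)
    (s := fun t => (s t).exp k) hD hβ0
    (fun t => by rw [h.succ, h.surr, ← hparam]; rfl)
    (by rw [h.zero]; exact h.norm_first_le (Sum.inr (Sum.inl k)))
    (by rw [h.zero, ← hparam]; rfl) hz I.T
  have hgap : ∀ t < I.T,
      |β * inner ℝ (g t) ((s t).aggregate - (s t).point (Sum.inr (Sum.inl k)))| ≤ 1 / 16 := by
    intro t ht
    have h3 := (h.valid ht.le).abs_inner_le (h.norm_g_le ht) (Sum.inr (Sum.inl k))
    rw [abs_mul, abs_of_pos hβ0]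
    nlinarith [mul_le_mul_of_nonneg_left h3 hβ0.le]
  have hgrad : ∀ t, expGrad β (g t) (s t).aggregate ((s t).exp k).1
      = (1 - β * inner ℝ (g t) ((s t).aggregate - (s t).point (Sum.inr (Sum.inl k)))) • g t := by
    intro t
    rw [← neg_sub ((s t).point (Sum.inr (Sum.inl k))), inner_neg_right, expGrad]
    simp only [point]
    module
  have h3 : ∑ t ∈ Finset.range I.T, ‖expGrad β (g t) (s t).aggregate ((s t).exp k).1‖ ^ 2
      ≤ 4 * ∑ t ∈ Finset.range I.T, ‖g t‖ ^ 2 := by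
    rw [Finset.mul_sum]
    refine Finset.sum_le_sum fun t ht => ?_
    rw [hgrad, norm_smul, mul_pow, Real.norm_eq_abs, sq_abs]
    have := abs_le.1 (hgap t (Finset.mem_range.1 ht))
    refine mul_le_mul_of_nonneg_right ?_ (sq_nonneg _)
    nlinarith
  have h4 : Real.log (1 + β ^ 2 * I.D ^ 2
        * (∑ t ∈ Finset.range I.T, ‖expGrad β (g t) (s t).aggregate ((s t).exp k).1‖ ^ 2) / d)
      ≤ Real.log (1 + β ^ 2 * (4 * I.D ^ 2 * ∑ t ∈ Finset.range I.T, ‖g t‖ ^ 2) / d) := by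
    have hS : 0 ≤ ∑ t ∈ Finset.range I.T,
        ‖expGrad β (g t) (s t).aggregate ((s t).exp k).1‖ ^ 2 :=
      Finset.sum_nonneg fun _ _ => by positivity
    refine Real.log_le_log (by positivity) ?_
    have := mul_le_mul_of_nonneg_left h3 (by positivity : 0 ≤ β ^ 2 * I.D ^ 2)
    gcongr 1 + ?_ / _
    linarith
  have h5 := mul_le_mul_of_nonneg_left h4 (by positivity : 0 ≤ d / (2 * β))
  have h6 : ∀ t ∈ Finset.range I.T, inner ℝ (g t) ((s t).aggregate - z)
        - 2 * β * (inner ℝ (g t) ((s t).aggregate - z)) ^ 2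
      ≤ (inner ℝ (g t) ((s t).aggregate - (s t).point (Sum.inr (Sum.inl k)))
        - β / 4 * (inner ℝ (g t) ((s t).aggregate - (s t).point (Sum.inr (Sum.inl k)))) ^ 2)
        + (inner ℝ (expGrad β (g t) (s t).aggregate ((s t).exp k).1) (((s t).exp k).1 - z)
        - β / 2 * (inner ℝ (expGrad β (g t) (s t).aggregate ((s t).exp k).1)
          (((s t).exp k).1 - z)) ^ 2) := by
    intro t ht
    have e : (s t).aggregate - z = ((s t).aggregate - (s t).point (Sum.inr (Sum.inl k)))
        + (((s t).exp k).1 - z) := by simp [point]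
    rw [e, inner_add_right, hgrad, inner_smul_left]
    exact exp_tradeoff hβ0 (hgap t (Finset.mem_range.1 ht))
  have h7 := Finset.sum_le_sum h6
  rw [Finset.sum_add_distrib] at h7
  have e : 9 * logCard I.T / (β / 4) = 36 * logCard I.T / β := by field_simp; ring
  linarith

/-- Linearized regret through the strongly convex expert with modulus `μ`. -/
theorem sc_le (h : IsRun I s x v g) (k : ModIdx I.T) {μ : ℝ}
    (hμ : modulus I.T k = μ) (hμ0 : 0 < μ) (hμ1 : μ ≤ 1) {z : Vec d} (hz : ‖z‖ ≤ I.D) :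
    ∑ t ∈ Finset.range I.T, (inner ℝ (g t) (x t - z)
        - μ / (2 * I.G ^ 2) * ‖g t‖ ^ 2 * ‖x t - z‖ ^ 2)
      ≤ 8 * (4 * I.G * I.D) * logCard I.T
        + μ / (4 * (I.G * I.D + I.G ^ 2)) * (4 * I.G * I.D) ^ 2
        + 36 * (I.G * I.D + I.G ^ 2) * logCard I.T / μ
        + (2 * I.D ^ 2 * (1 + 2 * I.D / I.G) ^ 2 + (I.G + 2 * I.D) ^ 2 / (2 * μ)
        * Real.log (1 + μ / (I.G + 2 * I.D) ^ 2 * ∑ t ∈ Finset.range I.T, ‖g t‖ ^ 2)) := by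
  have hD := h.D_pos
  have hG := h.G_pos
  set ρ := μ / (4 * (I.G * I.D + I.G ^ 2)) with hρ
  have hρ0 : 0 < ρ := by positivity
  have h1 := h.meta_sub_sq_le (Sum.inr (Sum.inr k)) hρ0
  have h2 := s2ogd_regret_le (g := g) (xt := x) (s := fun t => (s t).sc k) hD hG hμ0 hμ1
    (fun t => by rw [h.succ, h.surr, ← hμ]; rfl) (by rw [h.zero]; rfl)
    (by rw [h.zero]; exact h.norm_first_le (Sum.inr (Sum.inr k))) hz
    (fun t => (s t).aggregate) I.T (fun t ht => h.norm_g_le ht) h.norm_x_le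
  have h6 : ∀ t ∈ Finset.range I.T, inner ℝ (g t) (x t - z)
        - μ / (2 * I.G ^ 2) * ‖g t‖ ^ 2 * ‖x t - z‖ ^ 2
      ≤ (inner ℝ (g t) ((s t).aggregate - (s t).point (Sum.inr (Sum.inr k)))
        - ρ * (inner ℝ (g t) ((s t).aggregate - (s t).point (Sum.inr (Sum.inr k)))) ^ 2)
        + (scLoss μ I.G (g t) (s t).aggregate (x t) ((s t).sc k).1
          - scLoss μ I.G (g t) (s t).aggregate (x t) z) := by
    intro t ht
    have ht' := Finset.mem_range.1 ht
    simp only [point, scLoss]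
    set y := (s t).aggregate with hy
    set w := ((s t).sc k).1
    set c : ℝ := inner ℝ (g t) (y - x t) with hc
    set e : ℝ := inner ℝ (g t) (x t - w) with he
    have hc0 : 0 ≤ c := by rw [hc, h.surr]; exact inner_surrGrad_nonneg _ _ _
    have hcle : c ≤ 2 * I.G * I.D := by
      have a1 : ‖y - x t‖ ≤ I.D + I.D := (norm_sub_le _ _).trans
        (add_le_add (h.valid ht'.le).norm_aggregate_le (h.norm_x_le t ht'))
      calc c ≤ ‖g t‖ * ‖y - x t‖ := real_inner_le_norm _ _
        _ ≤ I.G * (I.D + I.D) := mul_le_mul (h.norm_g_le ht') a1 (norm_nonneg _) hG.le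
        _ = 2 * I.G * I.D := by ring
    have hesq : e ^ 2 ≤ ‖g t‖ ^ 2 * ‖w - x t‖ ^ 2 := by
      have := pow_le_pow_left₀ (abs_nonneg _) (abs_real_inner_le_norm (g t) (x t - w)) 2
      rwa [sq_abs, mul_pow, norm_sub_rev (x t)] at this
    have e1 : inner ℝ (g t) (y - w) = c + e := by
      rw [hc, he, ← inner_add_right]; congr 1; abel
    have e2 : inner ℝ (g t) (w - y) = -(c + e) := by
      rw [← e1, ← inner_neg_right, neg_sub]
    have e3 : inner ℝ (g t) (x t - z) = -c - inner ℝ (g t) (z - y) := by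
      rw [hc, ← inner_neg_right, ← inner_sub_right]; congr 1; abel
    rw [e1, e2, e3, norm_sub_rev z]
    -- The square of the gap is paid by `c`, the part of the gap between the aggregated point and
    -- its projection, and by the quadratic term of the loss of the expert.
    have h3 : ρ * (c + e) ^ 2 ≤ c + μ / (2 * I.G ^ 2) * ‖g t‖ ^ 2 * ‖w - x t‖ ^ 2 := by
      have b1 : (c + e) ^ 2 ≤ 4 * I.G * I.D * c + 2 * (‖g t‖ ^ 2 * ‖w - x t‖ ^ 2) := by
        nlinarith [sq_nonneg (c - e)]
      have b2 : ρ * (4 * I.G * I.D) ≤ 1 := by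
        rw [hρ, div_mul_eq_mul_div, div_le_one (by positivity)]
        nlinarith [mul_pos hG hD, sq_nonneg I.G]
      have b3 : ρ * 2 ≤ μ / (2 * I.G ^ 2) := by
        rw [hρ, div_mul_eq_mul_div, div_le_div_iff₀ (by positivity) (by positivity)]
        nlinarith [mul_pos hμ0 (mul_pos hG hD)]
      have b4 := mul_le_mul_of_nonneg_left b1 hρ0.le
      have b5 := mul_le_mul_of_nonneg_right b2 hc0
      have b6 := mul_le_mul_of_nonneg_right b3
        (by positivity : 0 ≤ ‖g t‖ ^ 2 * ‖w - x t‖ ^ 2)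
      linarith
    linarith
  have h7 := Finset.sum_le_sum h6
  rw [Finset.sum_add_distrib] at h7
  have e : 9 * logCard I.T / ρ = 36 * (I.G * I.D + I.G ^ 2) * logCard I.T / μ := by
    rw [hρ]; field_simp; ring
  linarith

end IsRun

/-! ### The grid of moduli -/

theorem exists_modulus {T : ℕ} (hT : 1 ≤ T) {m : ℝ} (hm : 1 / (T : ℝ) ≤ m) (hm1 : m ≤ 1) :
    ∃ k : ModIdx T, m / 2 ≤ modulus T k ∧ modulus T k ≤ m := by
  have hT0 : (0 : ℝ) < T := by exact_mod_cast hT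
  have h1 : 1 ≤ m * T := by rwa [div_le_iff₀ hT0] at hm
  have h2 : 1 ≤ ⌊m * T⌋₊ := Nat.one_le_floor_iff _ |>.2 h1
  have h3 : ⌊m * T⌋₊ ≤ T := Nat.floor_le_of_le (by nlinarith)
  have h4 : Nat.log 2 ⌊m * T⌋₊ ≤ Nat.clog 2 T :=
    (Nat.log_mono_right h3).trans (Nat.log_le_clog 2 T)
  refine ⟨⟨Nat.log 2 ⌊m * T⌋₊, by omega⟩, ?_, ?_⟩
  · have h5 := Nat.lt_pow_succ_log_self one_lt_two ⌊m * T⌋₊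
    have h6 : m * T < 2 ^ (Nat.log 2 ⌊m * T⌋₊ + 1) := by
      have := (Nat.floor_lt (by linarith)).1 h5
      exact_mod_cast this
    rw [modulus, div_le_div_iff₀ two_pos hT0]
    rw [pow_succ] at h6
    exact h6.le
  · have h5 := Nat.pow_log_le_self 2 (show ⌊m * T⌋₊ ≠ 0 by omega)
    rw [modulus, div_le_iff₀ hT0]
    refine le_trans ?_ (Nat.floor_le (by linarith))
    exact_mod_cast h5

/-! ### Small-loss regret bounds -/

/-- A run of the universal algorithm on admissible losses `f` over the domain `X`, together with
what the surrogate gradients `g` inherit from the projection onto `X`. -/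
structure IsSmoothRun {d : ℕ} (I : UniversalInput d) (X : Set (Vec d)) (H : ℝ)
    (f : ℕ → Vec d → ℝ) (s : ℕ → UniversalState d I.T) (x g : ℕ → Vec d) : Prop
    extends IsRun I s x (fun t => gradient (f t) (x t)) g where
  domain : IsFeasibleDomain X I.D
  H_pos : 0 < H
  loss : ∀ t < I.T, IsAdmissibleLoss (f t) X I.G H
  mem : ∀ t, x t ∈ X
  inner_le : ∀ t, ∀ z ∈ X, inner ℝ (gradient (f t) (x t)) (x t - z) ≤ inner ℝ (g t) (x t - z)

namespace IsSmoothRun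

variable {d : ℕ} {I : UniversalInput d} {X : Set (Vec d)} {H : ℝ} {f : ℕ → Vec d → ℝ}
  {s : ℕ → UniversalState d I.T} {x g : ℕ → Vec d}

theorem norm_le (h : IsSmoothRun I X H f s x g) {z : Vec d} (hz : z ∈ X) : ‖z‖ ≤ I.D := by
  simpa using h.domain.dist_le z hz 0 h.domain.zero_mem

theorem inner_g_le (h : IsSmoothRun I X H f s x g) (t : ℕ) (z : Vec d) :
    inner ℝ (g t) (x t - z) ≤ inner ℝ (g t) ((s t).aggregate - z) := by
  have h1 : 0 ≤ inner ℝ (g t) ((s t).aggregate - x t) := by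
    rw [h.surr]; exact inner_surrGrad_nonneg _ _ _
  have e : (s t).aggregate - z = ((s t).aggregate - x t) + (x t - z) := by abel
  rw [e, inner_add_right]
  linarith

theorem abs_inner_gradient_le (h : IsSmoothRun I X H f s x g) {t : ℕ} (ht : t < I.T) {z : Vec d}
    (hz : z ∈ X) : |(inner ℝ (gradient (f t) (x t)) (x t - z) : ℝ)| ≤ I.G * I.D :=
  (abs_real_inner_le_norm _ _).trans (mul_le_mul (h.norm_v_le t ht)
    (h.domain.dist_le _ (h.mem t) _ hz) (norm_nonneg _) h.G_pos.le)

theorem sum_loss_nonneg (h : IsSmoothRun I X H f s x g) {z : Vec d} (hz : z ∈ X) :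
    0 ≤ ∑ t ∈ Finset.range I.T, f t z :=
  Finset.sum_nonneg fun t ht => (h.loss t (Finset.mem_range.1 ht)).nonneg z
    (Metric.self_subset_cthickening _ hz)

theorem sum_norm_sq_le (h : IsSmoothRun I X H f s x g) :
    ∑ t ∈ Finset.range I.T, ‖g t‖ ^ 2 ≤ 4 * H * ∑ t ∈ Finset.range I.T, f t (x t) := by
  rw [Finset.mul_sum]
  refine Finset.sum_le_sum fun t ht => ?_
  exact (pow_le_pow_left₀ (norm_nonneg _) (h.norm_g_le_norm_v t) 2).trans
    ((h.loss t (Finset.mem_range.1 ht)).norm_gradient_sq_le h.H_pos h.G_pos (h.mem t))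

theorem convexOn_regret_le (h : IsSmoothRun I X H f s x g) (ha : 0 < I.a) (hδ : 0 < I.δ)
    (hf : ∀ t < I.T, ConvexOn ℝ X (f t)) {z : Vec d} (hz : z ∈ X) :
    ∑ t ∈ Finset.range I.T, f t (x t) - ∑ t ∈ Finset.range I.T, f t z
      ≤ 4 * I.G * I.D * (8 * logCard I.T + 6 * √(logCard I.T *
          (1 + (∑ t ∈ Finset.range I.T, ‖g t‖ ^ 2) / (4 * I.G ^ 2))))
        + (2 * I.D ^ 2 / I.a + I.a) * √(I.δ + ∑ t ∈ Finset.range I.T, ‖g t‖ ^ 2) := by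
  refine le_trans ?_ (h.convex_le ha hδ (h.norm_le hz))
  rw [← Finset.sum_sub_distrib]
  refine Finset.sum_le_sum fun t ht => ?_
  have ht' := Finset.mem_range.1 ht
  exact (convexOn_gradient_inequality (hf t ht') (h.mem t) hz
    ((h.loss t ht').differentiableAt (h.mem t))).trans
    ((h.inner_le t z hz).trans (h.inner_g_le t z))

/-- The quadratic lower models of exp-concave losses, for every sufficiently small coefficient. -/
theorem expConcave_sub_le (h : IsSmoothRun I X H f s x g) {α A : ℝ} {t : ℕ} (ht : t < I.T)
    (hf : IsExpConcaveOn (f t) α X) {z : Vec d} (hz : z ∈ X) (hA : 0 < A) (hAα : 4 * A ≤ α)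
    (hAGD : A * (16 * I.G * I.D) ≤ 1) :
    f t (x t) - f t z ≤ inner ℝ (gradient (f t) (x t)) (x t - z)
      - A * (inner ℝ (gradient (f t) (x t)) (x t - z)) ^ 2 := by
  have h1 := h.abs_inner_gradient_le ht hz
  have h2 := hf.sub_le (h.mem t) hz ((h.loss t ht).differentiableAt (h.mem t))
    (c := 4 * A) (by positivity) hAα
    (by have := mul_le_mul_of_nonneg_left h1 hA.le; linarith)
  linarith

/-- The regret bound that is linear in the horizon. -/
theorem expConcave_regret_le_mul (h : IsSmoothRun I X H f s x g) {α A : ℝ}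
    (hf : ∀ t < I.T, IsExpConcaveOn (f t) α X) {z : Vec d} (hz : z ∈ X) (hA : 0 < A)
    (hAα : 4 * A ≤ α) (hAGD : A * (16 * I.G * I.D) ≤ 1) :
    ∑ t ∈ Finset.range I.T, f t (x t) - ∑ t ∈ Finset.range I.T, f t z ≤ I.T * (I.G * I.D) := by
  rw [← Finset.sum_sub_distrib]
  refine (Finset.sum_le_card_nsmul _ _ (I.G * I.D) fun t ht => ?_).trans (le_of_eq (by simp))
  have ht' := Finset.mem_range.1 ht
  have h2 := (abs_le.1 (h.abs_inner_gradient_le ht' hz)).2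
  have h3 := h.expConcave_sub_le ht' (hf t ht') hz hA hAα hAGD
  have h5 : 0 ≤ A * (inner ℝ (gradient (f t) (x t)) (x t - z)) ^ 2 := by positivity
  linarith

theorem expConcave_regret_le (h : IsSmoothRun I X H f s x g) {α : ℝ}
    (hf : ∀ t < I.T, IsExpConcaveOn (f t) α X) {z : Vec d} (hz : z ∈ X) (k : ModIdx I.T) {β : ℝ}
    (hβ : modulus I.T k = 2 * β) (hβ0 : 0 < β) (hβα : 8 * β ≤ α)
    (hβ1 : β * (32 * I.G * I.D) ≤ 1) :
    ∑ t ∈ Finset.range I.T, f t (x t) - ∑ t ∈ Finset.range I.T, f t z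
      ≤ 8 * (4 * I.G * I.D) * logCard I.T + β / 4 * (4 * I.G * I.D) ^ 2
        + 36 * logCard I.T / β + 2 / β + d / (2 * β) * Real.log (1 + β ^ 2 * (4 * I.D ^ 2
          * ∑ t ∈ Finset.range I.T, ‖g t‖ ^ 2) / d) := by
  refine le_trans ?_ (h.exp_le k hβ hβ0 hβ1 (h.norm_le hz))
  rw [← Finset.sum_sub_distrib]
  refine Finset.sum_le_sum fun t ht => ?_
  have ht' := Finset.mem_range.1 ht
  refine (h.expConcave_sub_le ht' (hf t ht') hz (A := 2 * β) (by positivity) (by linarith)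
    (by linarith)).trans ?_
  have h1 := (h.inner_le t z hz).trans (h.inner_g_le t z)
  have h2 := (abs_le.1 (h.abs_inner_gradient_le ht' hz)).2
  have h3 : inner ℝ (g t) ((s t).aggregate - z) ≤ 2 * (I.G * I.D) := by
    have a1 : ‖(s t).aggregate - z‖ ≤ I.D + I.D := (norm_sub_le _ _).trans
      (add_le_add (h.valid ht'.le).norm_aggregate_le (h.norm_le hz))
    calc _ ≤ ‖g t‖ * ‖(s t).aggregate - z‖ := real_inner_le_norm _ _
      _ ≤ I.G * (I.D + I.D) := mul_le_mul (h.norm_g_le ht') a1 (norm_nonneg _) h.G_pos.le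
      _ = 2 * (I.G * I.D) := by ring
  -- The quadratic model is monotone on the range of the linear terms.
  set u : ℝ := inner ℝ (gradient (f t) (x t)) (x t - z)
  set w : ℝ := inner ℝ (g t) ((s t).aggregate - z)
  have h4 : 2 * β * (w + u) ≤ 1 := by
    have h5 := mul_le_mul_of_nonneg_left (show w + u ≤ 3 * (I.G * I.D) by linarith) hβ0.le
    linarith [mul_pos hβ0 (mul_pos h.G_pos h.D_pos)]
  linarith [mul_nonneg (sub_nonneg.2 h1) (sub_nonneg.2 h4)]

theorem stronglyConvex_regret_le (h : IsSmoothRun I X H f s x g) {mu : ℝ}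
    (hf : ∀ t < I.T, IsStronglyConvexOn (f t) mu X) {z : Vec d} (hz : z ∈ X) (k : ModIdx I.T)
    {μ : ℝ} (hμ : modulus I.T k = μ) (hμ0 : 0 < μ) (hμmu : μ ≤ mu) (hμ1 : μ ≤ 1) :
    ∑ t ∈ Finset.range I.T, f t (x t) - ∑ t ∈ Finset.range I.T, f t z
      ≤ 8 * (4 * I.G * I.D) * logCard I.T
        + μ / (4 * (I.G * I.D + I.G ^ 2)) * (4 * I.G * I.D) ^ 2
        + 36 * (I.G * I.D + I.G ^ 2) * logCard I.T / μ
        + (2 * I.D ^ 2 * (1 + 2 * I.D / I.G) ^ 2 + (I.G + 2 * I.D) ^ 2 / (2 * μ)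
        * Real.log (1 + μ / (I.G + 2 * I.D) ^ 2 * ∑ t ∈ Finset.range I.T, ‖g t‖ ^ 2)) := by
  have hG := h.G_pos
  refine le_trans ?_ (h.sc_le k hμ hμ0 hμ1 (h.norm_le hz))
  rw [← Finset.sum_sub_distrib]
  refine Finset.sum_le_sum fun t ht => ?_
  have ht' := Finset.mem_range.1 ht
  have h1 := hf t ht' (x t) (h.mem t) z hz
  rw [← neg_sub (x t) z, inner_neg_right, norm_neg] at h1
  have h2 := h.inner_le t z hz
  have h3 := h.norm_g_le ht'
  have h4 : μ / (2 * I.G ^ 2) * ‖g t‖ ^ 2 ≤ mu / 2 := by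
    calc μ / (2 * I.G ^ 2) * ‖g t‖ ^ 2 ≤ mu / (2 * I.G ^ 2) * I.G ^ 2 := by
          have := hμ0.le.trans hμmu
          gcongr
      _ = mu / 2 := by field_simp
  have h5 := mul_le_mul_of_nonneg_right h4 (sq_nonneg ‖x t - z‖)
  linarith

end IsSmoothRun

/-- The regret bound for convex losses, with a constant that depends only on the parameters. -/
theorem exists_convex_regret_bound (D G H a δ : ℝ) (hD : 0 < D) (hG : 0 < G) (hH : 0 < H)
    (ha : 0 < a) (hδ : 0 < δ) :
    ∃ C : ℝ, 0 < C ∧ ∀ (d T : ℕ) (first : Expert T → Vec d) (X : Set (Vec d))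
      (f : ℕ → Vec d → ℝ) (s : ℕ → UniversalState d T) (x g : ℕ → Vec d),
      IsSmoothRun ⟨T, D, G, a, δ, first⟩ X H f s x g → (∀ t < T, ConvexOn ℝ X (f t)) →
      ∀ z ∈ X, ∑ t ∈ Finset.range T, f t (x t) - ∑ t ∈ Finset.range T, f t z
        ≤ C * (√(logLog T * ∑ t ∈ Finset.range T, f t z) + logLog T) := by
  set c : ℝ := H / G ^ 2 + 4 * H / δ with hc
  set C₁ : ℝ := 32 * G * D + 24 * G * D + (2 * D ^ 2 / a + a) * √δ with hC₁
  have hc0 : 0 < c := by positivity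
  have hC₁0 : 0 < C₁ := by positivity
  refine ⟨3 * (2 * C₁ * (2 + C₁ * c + √c)), by positivity, ?_⟩
  intro d T first X f s x g h hf z hz
  have hΛ := one_le_logCard T
  have hκ : logCard T ≤ 3 * logLog T := logCard_le h.one_le_T
  set L := ∑ t ∈ Finset.range T, f t z with hLdef
  set F := ∑ t ∈ Finset.range T, f t (x t) with hFdef
  have hL : 0 ≤ L := h.sum_loss_nonneg hz
  rcases le_or_gt (F - L) 0 with hneg | hpos
  · have hκ0 : 0 ≤ logLog T := by linarith
    exact hneg.trans (by positivity)
  have hrun := h.convexOn_regret_le ha hδ hf hz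
  have hQ : ∑ t ∈ Finset.range T, ‖g t‖ ^ 2 ≤ 4 * H * F := h.sum_norm_sq_le
  dsimp only at hrun
  rw [← hFdef, ← hLdef] at hrun
  set Q := ∑ t ∈ Finset.range T, ‖g t‖ ^ 2 with hQdef
  have hQ0 : 0 ≤ Q := Finset.sum_nonneg fun _ _ => by positivity
  have hF : 0 < F := by linarith
  have hF' : L + (F - L) = F := by ring
  have h1 : √(logCard T * (1 + Q / (4 * G ^ 2))) ≤ √(logCard T * (1 + c * F)) := by
    refine Real.sqrt_le_sqrt (mul_le_mul_of_nonneg_left ?_ (by linarith))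
    have e : H / G ^ 2 * F = (4 * H * F) / (4 * G ^ 2) := by field_simp
    have e1 : Q / (4 * G ^ 2) ≤ (4 * H * F) / (4 * G ^ 2) := by gcongr
    have e2 : 0 ≤ 4 * H / δ * F := by positivity
    rw [hc]; linarith
  have h2 : √(δ + Q) ≤ √δ * √(logCard T * (1 + c * F)) := by
    rw [← Real.sqrt_mul hδ.le]
    refine Real.sqrt_le_sqrt ?_
    have e1 : δ * (4 * H / δ * F) = 4 * H * F := by field_simp
    have e2 : 0 ≤ H / G ^ 2 * F := by positivity
    have e3 : δ + Q ≤ δ * (1 + c * F) := by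
      rw [hc]; nlinarith [mul_nonneg hδ.le e2]
    have e4 : 0 ≤ δ * (1 + c * F) := by positivity
    nlinarith [mul_nonneg e4 (sub_nonneg.2 hΛ)]
  have h3 : F - L ≤ C₁ * (√(logCard T * (1 + c * (L + (F - L)))) + logCard T) := by
    rw [hF']
    set q := √(logCard T * (1 + c * F)) with hq
    have hq0 : 0 ≤ q := Real.sqrt_nonneg _
    have b1 := mul_le_mul_of_nonneg_left h1 (by positivity : 0 ≤ 4 * G * D * 6)
    have b2 := mul_le_mul_of_nonneg_left h2 (by positivity : 0 ≤ 2 * D ^ 2 / a + a)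
    have b3 : 0 ≤ 32 * G * D * q := by positivity
    have b4 : 0 ≤ (24 * G * D + (2 * D ^ 2 / a + a) * √δ) * logCard T := by
      have : 0 ≤ logCard T := by linarith
      positivity
    rw [hC₁]
    linarith
  refine (le_of_le_mul_sqrt hC₁0.le hc0.le hpos.le hL hΛ h3).trans ?_
  have h4 : √(logCard T * L) ≤ 3 * √(logLog T * L) := by
    have e : 3 * √(logLog T * L) = √(3 ^ 2 * (logLog T * L)) := by
      rw [Real.sqrt_mul (by positivity) (logLog T * L), Real.sqrt_sq (by norm_num)]
    rw [e]
    refine Real.sqrt_le_sqrt ?_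
    have hκ1 := one_le_logLog h.one_le_T
    have := mul_le_mul_of_nonneg_right hκ hL
    have : 0 ≤ logLog T * L := by positivity
    linarith
  have h5 : 0 ≤ 2 * C₁ * (2 + C₁ * c + √c) := by positivity
  have h6 := mul_le_mul_of_nonneg_left (add_le_add h4 hκ) h5
  linarith

/-- The self-bounding inequality of the exp-concave case, solved for `β` times the regret. -/
theorem le_of_expConcave_bound {D H M Λ β F L Q : ℝ} {d : ℕ} (hD : 0 < D) (hH : 0 < H)
    (hM0 : 0 < M) (hβ0 : 0 < β) (hβ1 : β ≤ 1) (hΛ : 1 ≤ Λ) (hL : 0 ≤ L) (hpos : 0 < F - L)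
    (hQ0 : 0 ≤ Q) (hQ : Q ≤ 4 * H * F)
    (h : F - L ≤ 8 * M * Λ + β / 4 * M ^ 2 + 36 * Λ / β + 2 / β
      + d / (2 * β) * Real.log (1 + β ^ 2 * (4 * D ^ 2 * Q) / d)) :
    β * (F - L) ≤ 2 * (8 * M + M ^ 2 + 39)
      * (1 + 16 * D ^ 2 * H + |Real.log (2 * (8 * M + M ^ 2 + 39) * (16 * D ^ 2 * H))|)
      * (Λ + d * (1 + Real.log (1 + L))) := by
  have hΛ0 : 0 ≤ Λ := by linarith
  refine le_of_le_log d (by positivity) (by positivity) (by positivity) hL hΛ ?_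
  set r : ℝ := β * (F - L) with hr
  have hr0 : 0 < r := by positivity
  have h1 : Real.log (1 + β ^ 2 * (4 * D ^ 2 * Q) / d)
      ≤ Real.log (1 + 16 * D ^ 2 * H * (L + r) / d) := by
    refine Real.log_le_log (by positivity) ?_
    gcongr 1 + ?_ / _
    have e1 : β ^ 2 * F ≤ L + r := by
      have e2 : β ^ 2 * F = β ^ 2 * L + β * r := by rw [hr]; ring
      have e3 : β ^ 2 * L ≤ L := mul_le_of_le_one_left hL (pow_le_one₀ hβ0.le hβ1)
      have e4 : β * r ≤ r := mul_le_of_le_one_left hr0.le hβ1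
      linarith
    calc β ^ 2 * (4 * D ^ 2 * Q) ≤ β ^ 2 * (4 * D ^ 2 * (4 * H * F)) := by gcongr
      _ = 16 * D ^ 2 * H * (β ^ 2 * F) := by ring
      _ ≤ 16 * D ^ 2 * H * (L + r) := by gcongr
  have hlog1 : 0 ≤ Real.log (1 + 16 * D ^ 2 * H * (L + r) / d) :=
    Real.log_nonneg (by
      have : 0 ≤ 16 * D ^ 2 * H * (L + r) / d := by positivity
      linarith)
  set ℓ' : ℝ := Real.log (1 + β ^ 2 * (4 * D ^ 2 * Q) / d)
  have e : β * (8 * M * Λ + β / 4 * M ^ 2 + 36 * Λ / β + 2 / β + d / (2 * β) * ℓ')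
      = 8 * M * Λ * β + β ^ 2 / 4 * M ^ 2 + 36 * Λ + 2 + d * ℓ' / 2 := by
    field_simp
  have h3 := (mul_le_mul_of_nonneg_left h hβ0.le).trans (le_of_eq e)
  have h4 := mul_le_mul_of_nonneg_left h1 (Nat.cast_nonneg (α := ℝ) d)
  set ℓ : ℝ := d * Real.log (1 + 16 * D ^ 2 * H * (L + r) / d)
  have hℓ0 : 0 ≤ ℓ := by positivity
  have b1 : 8 * M * Λ * β ≤ 8 * M * Λ := mul_le_of_le_one_right (by positivity) hβ1
  have b2 : β ^ 2 / 4 * M ^ 2 ≤ Λ * M ^ 2 := by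
    have : β ^ 2 ≤ 1 := pow_le_one₀ hβ0.le hβ1
    exact mul_le_mul_of_nonneg_right (by linarith) (sq_nonneg M)
  have b3 : 0 ≤ (8 * M + M ^ 2 + 38) * ℓ := by positivity
  linarith

/-- The regret bound for exp-concave losses, with a constant that depends only on the parameters. -/
theorem exists_expConcave_regret_bound (D G H a δ : ℝ) (hD : 0 < D) (hG : 0 < G) (hH : 0 < H) :
    ∃ C : ℝ, 0 < C ∧ ∀ (d T : ℕ) (first : Expert T → Vec d) (X : Set (Vec d))
      (f : ℕ → Vec d → ℝ) (s : ℕ → UniversalState d T) (x g : ℕ → Vec d),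
      IsSmoothRun ⟨T, D, G, a, δ, first⟩ X H f s x g → ∀ α : ℝ, 0 < α → α ≤ 1 →
      (∀ t < T, IsExpConcaveOn (f t) α X) →
      ∀ z ∈ X, ∑ t ∈ Finset.range T, f t (x t) - ∑ t ∈ Finset.range T, f t z
        ≤ C / α * (d * (1 + Real.log (1 + ∑ t ∈ Finset.range T, f t z)) + logLog T) := by
  set γ : ℝ := min 1 (1 / (4 * G * D)) / 4 with hγ
  set M : ℝ := 4 * G * D with hM
  set c : ℝ := 16 * D ^ 2 * H with hc
  set C₁ : ℝ := 8 * M + M ^ 2 + 39 with hC₁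
  set C₂ : ℝ := 2 * C₁ * (1 + c + |Real.log (2 * C₁ * c)|) with hC₂
  have hM0 : 0 < M := by positivity
  have hGD : 0 < G * D := by positivity
  have hmin : 0 < min 1 (1 / (4 * G * D)) := lt_min one_pos (by positivity)
  have hγ0 : 0 < γ := by positivity
  have hγ1 : 4 * γ ≤ 1 := by
    have := min_le_left 1 (1 / (4 * G * D)); rw [hγ]; linarith
  have hγGD : γ * (16 * G * D) ≤ 1 := by
    have h1 := mul_le_mul_of_nonneg_right (min_le_right 1 (1 / (4 * G * D)))
      (by positivity : 0 ≤ 4 * G * D)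
    have h2 : 1 / (4 * G * D) * (4 * G * D) = 1 := by field_simp
    rw [hγ]; linarith
  have hc0 : 0 < c := by positivity
  have hC₁0 : 0 < C₁ := by positivity
  have hC₂0 : 0 < C₂ := by positivity
  clear_value γ M c C₁ C₂
  refine ⟨(12 * C₂ + G * D) / γ, by positivity, ?_⟩
  intro d T first X f s x g h α hα hα1 hf z hz
  have hΛ := one_le_logCard T
  have hκ : logCard T ≤ 3 * logLog T := logCard_le h.one_le_T
  have hκ1 : 1 ≤ logLog T := one_le_logLog h.one_le_T
  set L := ∑ t ∈ Finset.range T, f t z with hLdef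
  set F := ∑ t ∈ Finset.range T, f t (x t) with hFdef
  have hL : 0 ≤ L := h.sum_loss_nonneg hz
  have hlog : 0 ≤ Real.log (1 + L) := Real.log_nonneg (by linarith)
  set B : ℝ := d * (1 + Real.log (1 + L)) + logLog T with hB
  have hB1 : 1 ≤ B := by
    have : 0 ≤ d * (1 + Real.log (1 + L)) := by positivity
    linarith
  have hB0 : 0 ≤ B := by linarith
  rcases le_or_gt (F - L) 0 with hneg | hpos
  · exact hneg.trans (by positivity)
  -- `4 m` is the modulus of the quadratic lower models of the losses.
  set m : ℝ := γ * α with hm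
  have hm0 : 0 < m := by positivity
  have hmα : 4 * m ≤ α := by
    have := mul_le_mul_of_nonneg_right hγ1 hα.le
    rw [hm]; linarith
  have hmGD : m * (16 * G * D) ≤ 1 := by
    refine le_trans (mul_le_mul_of_nonneg_right ?_ (by positivity)) hγGD
    exact mul_le_of_le_one_right hγ0.le hα1
  rcases lt_or_ge m (1 / (T : ℝ)) with hmT | hmT
  · -- No expert has a modulus as small as `m`, but then `T` itself is of order `1 / α`.
    have hT0 : (0 : ℝ) < T := by exact_mod_cast h.one_le_T
    have h1 : F - L ≤ T * (G * D) := h.expConcave_regret_le_mul hf hz hm0 hmα hmGD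
    have h3 : (T : ℝ) ≤ 1 / m := by
      rw [le_div_iff₀ hm0]
      rw [lt_div_iff₀ hT0] at hmT
      linarith
    have e : (12 * C₂ + G * D) / γ / α * B = 1 / m * ((12 * C₂ + G * D) * B) := by
      rw [hm]; field_simp
    rw [e]
    refine h1.trans (mul_le_mul h3 ?_ hGD.le (by positivity))
    have := mul_le_mul_of_nonneg_left hB1 hGD.le
    have := mul_nonneg hC₂0.le hB0
    linarith
  obtain ⟨k, hk1, hk2⟩ := exists_modulus h.one_le_T hmT (by linarith)
  set β : ℝ := modulus T k / 2 with hβ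
  have hkβ : modulus T k = 2 * β := by rw [hβ]; ring
  have hβ0 : 0 < β := by linarith
  have hβ1 : β ≤ 1 := by linarith
  have hβGD : β * (32 * G * D) ≤ 1 := by
    have := mul_le_mul_of_nonneg_right (show 2 * β ≤ m by linarith)
      (by positivity : 0 ≤ 16 * G * D)
    linarith
  have hrun := h.expConcave_regret_le hf hz k hkβ hβ0 (by linarith) hβGD
  have hQ : ∑ t ∈ Finset.range T, ‖g t‖ ^ 2 ≤ 4 * H * F := h.sum_norm_sq_le
  dsimp only at hrun
  rw [← hFdef, ← hLdef, ← hM] at hrun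
  have h3 := le_of_expConcave_bound (H := H) hD hH hM0 hβ0 hβ1 hΛ hL hpos
    (Finset.sum_nonneg fun _ _ => by positivity) hQ hrun
  rw [← hc, ← hC₁, ← hC₂] at h3
  have h4 : β * (F - L) ≤ 3 * C₂ * B := by
    refine h3.trans ?_
    have h5 : 0 ≤ d * (1 + Real.log (1 + L)) := by positivity
    have h6 := mul_le_mul_of_nonneg_left
      (show logCard T + d * (1 + Real.log (1 + L)) ≤ 3 * B by rw [hB]; linarith) hC₂0.le
    linarith
  have h5 : m / 4 * (F - L) ≤ 3 * C₂ * B :=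
    (mul_le_mul_of_nonneg_right (by linarith) hpos.le).trans h4
  have e : (12 * C₂ + G * D) / γ / α * B = ((12 * C₂ + G * D) * B) / m := by
    rw [hm]; field_simp
  rw [e, le_div_iff₀ hm0]
  have := mul_nonneg hGD.le hB0
  linarith

/-- The regret bound for strongly convex losses, with a constant that depends only on the parameters.
-/
theorem exists_stronglyConvex_regret_bound (D G H a δ : ℝ) (hD : 0 < D) (hG : 0 < G)
    (hH : 0 < H) :
    ∃ C : ℝ, 0 < C ∧ ∀ (d T : ℕ) (first : Expert T → Vec d) (X : Set (Vec d))
      (f : ℕ → Vec d → ℝ) (s : ℕ → UniversalState d T) (x g : ℕ → Vec d),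
      IsSmoothRun ⟨T, D, G, a, δ, first⟩ X H f s x g → ∀ mu : ℝ, 1 / (T : ℝ) ≤ mu → mu ≤ 1 →
      (∀ t < T, IsStronglyConvexOn (f t) mu X) →
      ∀ z ∈ X, ∑ t ∈ Finset.range T, f t (x t) - ∑ t ∈ Finset.range T, f t z
        ≤ C / mu * (Real.log (1 + ∑ t ∈ Finset.range T, f t z) + logLog T) := by
  set M : ℝ := 4 * G * D with hM
  set N : ℝ := G * D + G ^ 2 with hN
  set c : ℝ := 4 * H / (G + 2 * D) ^ 2 with hc
  set C₁ : ℝ := 8 * M + M ^ 2 / (4 * N) + 36 * N + 2 * D ^ 2 * (1 + 2 * D / G) ^ 2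
    + (G + 2 * D) ^ 2 / 2 with hC₁
  set C₂ : ℝ := 2 * C₁ * (1 + c + |Real.log (2 * C₁ * c)|) with hC₂
  have hM0 : 0 < M := by positivity
  have hN0 : 0 < N := by positivity
  have hc0 : 0 < c := by positivity
  have hC₁0 : 0 < C₁ := by positivity
  have hC₂0 : 0 < C₂ := by positivity
  clear_value M N c C₁ C₂
  refine ⟨8 * C₂, by positivity, ?_⟩
  intro d T first X f s x g h mu hmuT hmu1 hf z hz
  have hT0 : (0 : ℝ) < T := by exact_mod_cast h.one_le_T
  have hmu0 : 0 < mu := lt_of_lt_of_le (by positivity) hmuT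
  have hΛ := one_le_logCard T
  have hκ : logCard T ≤ 3 * logLog T := logCard_le h.one_le_T
  have hκ1 : 1 ≤ logLog T := one_le_logLog h.one_le_T
  set L := ∑ t ∈ Finset.range T, f t z with hLdef
  set F := ∑ t ∈ Finset.range T, f t (x t) with hFdef
  have hL : 0 ≤ L := h.sum_loss_nonneg hz
  have hlog : 0 ≤ Real.log (1 + L) := Real.log_nonneg (by linarith)
  rcases le_or_gt (F - L) 0 with hneg | hpos
  · exact hneg.trans (by positivity)
  obtain ⟨k, hk1, hk2⟩ := exists_modulus h.one_le_T hmuT hmu1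
  set μ : ℝ := modulus T k with hμ
  have hμ0 : 0 < μ := by linarith
  have hμ1 : μ ≤ 1 := by linarith
  have hrun := h.stronglyConvex_regret_le hf hz k hμ.symm hμ0 hk2 hμ1
  have hQ : ∑ t ∈ Finset.range T, ‖g t‖ ^ 2 ≤ 4 * H * F := h.sum_norm_sq_le
  dsimp only at hrun
  rw [← hFdef, ← hLdef, ← hM, ← hN] at hrun
  set Q := ∑ t ∈ Finset.range T, ‖g t‖ ^ 2 with hQdef
  have hQ0 : 0 ≤ Q := Finset.sum_nonneg fun _ _ => by positivity
  set r : ℝ := μ * (F - L) with hr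
  have hr0 : 0 < r := by positivity
  have h1 : Real.log (1 + μ / (G + 2 * D) ^ 2 * Q) ≤ Real.log (1 + c * (L + r)) := by
    refine Real.log_le_log (by positivity) ?_
    gcongr 1 + ?_
    have e1 : μ * F ≤ L + r := by
      have e2 : μ * F = μ * L + r := by rw [hr]; ring
      nlinarith
    calc μ / (G + 2 * D) ^ 2 * Q ≤ μ / (G + 2 * D) ^ 2 * (4 * H * F) := by gcongr
      _ = c * (μ * F) := by rw [hc]; ring
      _ ≤ c * (L + r) := by gcongr
  have hlog1 : 0 ≤ Real.log (1 + c * (L + r)) :=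
    Real.log_nonneg (by
      have : 0 ≤ c * (L + r) := by positivity
      linarith)
  have h2 : r ≤ C₁ * (logCard T + Real.log (1 + c * (L + r))) := by
    set ℓ' : ℝ := Real.log (1 + μ / (G + 2 * D) ^ 2 * Q)
    have e : μ * (8 * M * logCard T + μ / (4 * N) * M ^ 2 + 36 * N * logCard T / μ
        + (2 * D ^ 2 * (1 + 2 * D / G) ^ 2 + (G + 2 * D) ^ 2 / (2 * μ)
          * ℓ')) = 8 * M * logCard T * μ + M ^ 2 / (4 * N) * μ ^ 2 + 36 * N * logCard T
        + 2 * D ^ 2 * (1 + 2 * D / G) ^ 2 * μ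
        + (G + 2 * D) ^ 2 / 2 * ℓ' := by
      field_simp
      ring
    have h3 := (mul_le_mul_of_nonneg_left hrun hμ0.le).trans (le_of_eq e)
    have h4 := mul_le_mul_of_nonneg_left h1 (by positivity : 0 ≤ (G + 2 * D) ^ 2 / 2)
    set ℓ : ℝ := Real.log (1 + c * (L + r)) with hℓ
    have b1 : 8 * M * logCard T * μ ≤ 8 * M * logCard T :=
      mul_le_of_le_one_right (by positivity) hμ1
    have b2 : M ^ 2 / (4 * N) * μ ^ 2 ≤ M ^ 2 / (4 * N) * logCard T :=
      mul_le_mul_of_nonneg_left ((pow_le_one₀ hμ0.le hμ1).trans hΛ) (by positivity)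
    have b3 : 2 * D ^ 2 * (1 + 2 * D / G) ^ 2 * μ ≤ 2 * D ^ 2 * (1 + 2 * D / G) ^ 2 * logCard T :=
      mul_le_mul_of_nonneg_left (hμ1.trans hΛ) (by positivity)
    have b4 : 0 ≤ (8 * M + M ^ 2 / (4 * N) + 36 * N + 2 * D ^ 2 * (1 + 2 * D / G) ^ 2) * ℓ := by
      positivity
    have b5 : 0 ≤ (G + 2 * D) ^ 2 / 2 * logCard T := by
      have : 0 ≤ logCard T := by linarith
      positivity
    rw [hC₁]
    linarith
  have h3 := le_of_le_log 1 hC₁0 hc0 hr0.le hL hΛ (by simpa using h2)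
  rw [← hC₂, Nat.cast_one, one_mul] at h3
  have h4 : r ≤ 4 * C₂ * (Real.log (1 + L) + logLog T) := by
    refine h3.trans ?_
    have h6 := mul_le_mul_of_nonneg_left (show logCard T + (1 + Real.log (1 + L))
      ≤ 4 * (Real.log (1 + L) + logLog T) by linarith) hC₂0.le
    linarith
  have h5 : mu / 2 * (F - L) ≤ 4 * C₂ * (Real.log (1 + L) + logLog T) :=
    (mul_le_mul_of_nonneg_right hk1 hpos.le).trans h4
  rw [div_mul_eq_mul_div, le_div_iff₀ hmu0]
  linarith

/-! ### The universal algorithm on admissible losses -/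

theorem IsFeasibleDomain.isCompact {d : ℕ} {X : Set (Vec d)} {D : ℝ} (hX : IsFeasibleDomain X D) :
    IsCompact X := by
  refine (isCompact_closedBall (0 : Vec d) D).of_isClosed_subset hX.closed fun z hz => ?_
  simpa using hX.dist_le z hz 0 hX.zero_mem

theorem theorem2 (D G H a δ : ℝ) (hD : 0 < D) (hG : 0 < G) (hH : 0 < H) (ha : 0 < a)
    (hδ : 0 < δ) :
    -- exactly one projection onto the feasible domain per round
    (∀ (d : ℕ) (I : UniversalInput d) (P : Vec d → Vec d) (grad : ℕ → Vec d → Vec d) (t : ℕ),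
      (universalLearner I).projCount P grad t = 1) ∧
    -- small-loss regret
    ∃ C : ℝ, 0 < C ∧
      ∀ (d T : ℕ) (_ : 1 ≤ T) (first : Expert T → Vec d) (_ : ∀ i, ‖first i‖ ≤ D)
        (X : Set (Vec d)) (_ : IsFeasibleDomain X D)
        (P : Vec d → Vec d) (_ : IsProjectionOnto P X)
        (f : ℕ → Vec d → ℝ) (_ : ∀ t < T, IsAdmissibleLoss (f t) X G H),
        ∃ L : ℝ, IsLeast ((fun x => ∑ t ∈ Finset.range T, f t x) '' X) L ∧
          let x : ℕ → Vec d :=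
            (universalLearner ⟨T, D, G, a, δ, first⟩).decision P fun t => gradient (f t)
          let regret : ℝ := ∑ t ∈ Finset.range T, f t (x t) - L
          ((∀ t < T, ConvexOn ℝ X (f t)) →
            regret ≤ C * (√(logLog T * L) + logLog T)) ∧
          (∀ α : ℝ, 1 / (T : ℝ) ≤ α → α ≤ 1 → (∀ t < T, IsExpConcaveOn (f t) α X) →
            regret ≤ C / α * (d * (1 + Real.log (1 + L)) + logLog T)) ∧
          (∀ mu : ℝ, 1 / (T : ℝ) ≤ mu → mu ≤ 1 → (∀ t < T, IsStronglyConvexOn (f t) mu X) →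
            regret ≤ C / mu * (Real.log (1 + L) + logLog T)) := by
  refine ⟨fun d I P grad t => rfl, ?_⟩
  obtain ⟨C₁, hC₁, hconv⟩ := exists_convex_regret_bound D G H a δ hD hG hH ha hδ
  obtain ⟨C₂, hC₂, hexp⟩ := exists_expConcave_regret_bound D G H a δ hD hG hH
  obtain ⟨C₃, hC₃, hsc⟩ := exists_stronglyConvex_regret_bound D G H a δ hD hG hH
  refine ⟨C₁ + C₂ + C₃, by positivity, ?_⟩
  intro d T hT first hfirst X hX P hP f hf
  have hcont : ContinuousOn (fun x => ∑ t ∈ Finset.range T, f t x) X :=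
    continuousOn_finsetSum _ fun t ht x hx =>
      ((hf t (Finset.mem_range.1 ht)).differentiableAt hx).continuousAt.continuousWithinAt
  obtain ⟨z, hz, hmin⟩ := hX.isCompact.exists_isMinOn ⟨0, hX.zero_mem⟩ hcont
  refine ⟨∑ t ∈ Finset.range T, f t z, ⟨⟨z, hz, rfl⟩, ?_⟩, ?_⟩
  · rintro _ ⟨y, hy, rfl⟩
    exact hmin hy
  set I : UniversalInput d := ⟨T, D, G, a, δ, first⟩ with hI
  let s : ℕ → UniversalState d T :=
    (universalLearner I).stateAt P fun t => gradient (f t)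
  intro x regret
  have hxP : ∀ t, x t = P (s t).aggregate := fun t => rfl
  have hxX : ∀ t, x t ∈ X := fun t => by rw [hxP]; exact (hP _).1
  have hrun : IsSmoothRun I X H f s x
      (fun t => surrGrad (s t).aggregate (x t) (gradient (f t) (x t))) :=
    { D_pos := hD
      G_pos := hG
      one_le_T := hT
      norm_first_le := hfirst
      zero := rfl
      succ := fun t => rfl
      surr := fun t => rfl
      norm_x_le := fun t _ => by simpa using hX.dist_le _ (hxX t) 0 hX.zero_mem
      norm_v_le := fun t ht => (hf t ht).grad_le _ (hxX t)
      domain := hX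
      H_pos := hH
      loss := hf
      mem := hxX
      inner_le := fun t y hy => by
        rw [hxP]; exact inner_le_inner_surrGrad hP hX.convex _ _ hy }
  have hκ : 0 ≤ logLog T := by linarith [one_le_logLog hT]
  have hL : 0 ≤ ∑ t ∈ Finset.range T, f t z := hrun.sum_loss_nonneg hz
  have hlog := Real.log_nonneg (x := 1 + ∑ t ∈ Finset.range T, f t z) (by linarith)
  refine ⟨fun hc => ?_, fun α hα hα1 he => ?_, fun mu hmu hmu1 hm => ?_⟩
  · refine (hconv d T first X f s x _ hrun hc z hz).trans ?_
    gcongr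
    linarith
  · have hα0 : 0 < α := lt_of_lt_of_le (by positivity) hα
    refine (hexp d T first X f s x _ hrun α hα0 hα1 he z hz).trans ?_
    gcongr
    linarith
  · have hmu0 : 0 < mu := lt_of_lt_of_le (by positivity) hmu
    refine (hsc d T first X f s x _ hrun mu hmu hmu1 hm z hz).trans ?_
    gcongr
    linarith
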